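/- **Setting.** There are $K$ arms and $T\ge 2$ rounds, with $1\le L\le K\le T$. The reward vectors $x(t)=(x_i(t))_{i\in[K]}\in[0,1]^K$, $t=1,2,\dots$, are independent over $t$, with means $\mu_{i,t}=\mathbb E[x_i(t)]$ (an \emph{environment}). In each round an algorithm, possibly randomized, selects a set $I(t)\subseteq[K]$ with $|I(t)|=L$ on the basis of its past observations, and observes $x_i(t)$ for $i\in I(t)$. Its regret is $$\mathrm{Reg}(S)=\sum_{t=1}^{S}\Big(\max_{|I|=L}\sum_{i\in I}\mu_{i,t}-\sum_{i\in I(t)}\mu_{i,t}\Big).$$ Let $\epsilon(t)=\max_{i}\max_{s,s'\le t}|\mu_{i,s}-\mu_{i,s'}|$ be the maximum drift of the arms by round $t$. A base bandit algorithm has *strong drift-tolerant regret* with factor $c$ at horizon $T$ if in every environment, when it is run alone, with probability at least $1-4K/T^2$ $$\mathrm{Reg}(S)\le c\Big(\sqrt{LKS}+L\sum_{t\le S}\epsilon(t)\Big)\qquad\text{for all } S\in\{1,\dots,T\}.$$ It has *monitoring consistency* with parameter $D$ if in every environment, when it is run alone for $T$ rounds, almost surely some arm is selected at least once in any $D$ consecutive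 rounds. *ADR-bandit* with confidence level $\delta$ runs the base bandit. After each round let $W$ be the set of rounds since the last (re-)initialization. If there are an arm $i$ and a split of $W$ into consecutive windows $W_1\cup W_2$, both containing rounds in which $i$ was selected, such that $$|\hat\mu_{i,W_1}-\hat\mu_{i,W_2}|\ge\sqrt{\frac{\log(1/\delta)}{2|W_{i,1}|}}+\sqrt{\frac{\log(1/\delta)}{2|W_{i,2}|}},$$ then $W$ is emptied and the base bandit is re-initialized. Here $W_{i,k}$ is the set of rounds of $W_k$ in which $i$ was selected and $\hat\mu_{i,W_k}$ is the mean of the rewards of arm $i$ observed in them. **Theorem (Regret bound of the ADR-bandit under gradual changes).** Let $0<d<3/2$, $C^{\mathrm{gr}}\in(0,1]$, $D\in\mathbb N$, $A\in\mathbb R$ and $p\in\mathbb N$. There are constants $C$ and $q$, depending only on $d,C^{\mathrm{gr}},D,A,p$, such that the following holds for all $T\ge2$ and $1\le L\le K\le T$. Suppose that the base bandit has strong drift-tolerant regret with factor $A(\log T)^p$ at horizon $T$ and monitoring consistency with parameter $D$. Suppose that the environment is gradual with speed $b=T^{-d}$, i.e. $|\mu_{i,t+1}-\mu_{i,t}|\le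 b$ for all arms $i$ and $1\le t<T$, and that its changes are global, i.e. $|\mu_{i,t}-\mu_{i,s}|\ge C^{\mathrm{gr}}|\mu_{j,t}-\mu_{j,s}|$ for all arms $i,j$ and all $s,t\in[T]$. Then $\mathrm{Reg}(T)$ of ADR-bandit with $\delta=1/T^3$ is integrable, and $$\mathbb E[\mathrm{Reg}(T)]\le C(\log T)^q\sqrt{LK}\,T^{1-d/3}.$$ -/

import Mathlib

open MeasureTheory unitInterval

noncomputable section

/-- An environment with `K` arms. Rounds are numbered `0, 1, 2, …`. The reward vector of round `t`
has law `law t` on `[0,1]^K` (the arms may be dependent within one round); reward vectors of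
different rounds are independent, see `Environment.sampleMeasure`. -/
structure Environment (K : ℕ) where
  law : ℕ → Measure (Fin K → I)
  isProb : ∀ t, IsProbabilityMeasure (law t)

attribute [instance] Environment.isProb

namespace Environment

variable {K : ℕ}

/-- The mean `μ_{i,t}` of arm `i` in round `t`. -/
def mean (E : Environment K) (i : Fin K) (t : ℕ) : ℝ := ∫ x, (x i : ℝ) ∂(E.law t)

/-- The sample space: for every round a seed for the internal randomization of the
algorithm and the vector of rewards of all arms. Seeds are uniform on `[0,1]`, and all seeds and all
reward vectors are independent. -/
def sampleMeasure (E : Environment K) : Measure (ℕ → I × (Fin K → I)) :=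
  Measure.infinitePi fun t => (volume : Measure I).prod (E.law t)

/-- The largest expected total reward of `L` distinct arms in round `t`. -/
def topL (E : Environment K) (L t : ℕ) : ℝ :=
  ⨆ J : {J : Finset (Fin K) // J.card = L}, ∑ i ∈ J.1, E.mean i t

/-- The regret in the rounds `0, …, S - 1` of a sequence of selections. -/
def regret (E : Environment K) (L : ℕ) (sel : ℕ → Finset (Fin K)) (S : ℕ) : ℝ :=
  ∑ t ∈ Finset.range S, (E.topL L t - ∑ i ∈ sel t, E.mean i t)

/-- The maximum drift of the arms by round `t`:
`ε(t) = max_i max_{s, s' ≤ t} |μ_{i,s} - μ_{i,s'}|`. -/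
def drift (E : Environment K) (t : ℕ) : ℝ :=
  ⨆ q : Fin K × Fin (t + 1) × Fin (t + 1), |E.mean q.1 q.2.1 - E.mean q.1 q.2.2|

/-- The accumulated one-step drift over the first `S` rounds,
`∑ max_i |μ_{i,s} - μ_{i,s+1}|`. -/
def totalVariation (E : Environment K) (S : ℕ) : ℝ :=
  ∑ s ∈ Finset.range (S - 1), ⨆ i : Fin K, |E.mean i s - E.mean i (s + 1)|

/-- The environment drifts gradually with speed `b` during the rounds `0, …, T - 1`. -/
def Gradual (E : Environment K) (T : ℕ) (b : ℝ) : Prop :=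
  ∀ i : Fin K, ∀ t : ℕ, t + 1 < T → |E.mean i (t + 1) - E.mean i t| ≤ b

/-- The changes during the rounds `0, …, T - 1` are global: the drifts of any two arms between any
two rounds are proportional up to the factor `c`. -/
def GlobalChanges (E : Environment K) (T : ℕ) (c : ℝ) : Prop :=
  ∀ i j : Fin K, ∀ s t : ℕ, s < T → t < T →
    c * |E.mean j t - E.mean j s| ≤ |E.mean i t - E.mean i s|

/-- A regret bound in terms of the accumulated one-step drift is stronger than one in terms of
`∑ t, ε(t)`. -/
theorem totalVariation_le_sum_drift (E : Environment K) (S : ℕ) :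
    E.totalVariation S ≤ ∑ t ∈ Finset.range S, E.drift t := by
  have hnn : ∀ t, 0 ≤ E.drift t := fun t => Real.iSup_nonneg fun q => abs_nonneg _
  rcases S with _ | S
  · simp [totalVariation]
  · rw [Finset.sum_range_succ']
    refine le_trans (Finset.sum_le_sum fun s _ => ?_) (le_add_of_nonneg_right (hnn 0))
    refine Real.iSup_le (fun i => ?_) (hnn _)
    have hle := le_ciSup (f := fun q : Fin K × Fin (s + 1 + 1) × Fin (s + 1 + 1) =>
      |E.mean q.1 q.2.1 - E.mean q.1 q.2.2|) (Set.finite_range _).bddAbove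
      (i, ⟨s, by omega⟩, ⟨s + 1, by omega⟩)
    exact hle

end Environment

/-- The bandit feedback: the rewards of the selected arms, the others replaced by `0`. -/
def feedback {K : ℕ} (J : Finset (Fin K)) (x : Fin K → I) : Fin K → I :=
  fun i => if i ∈ J then x i else 0

/-- A (randomized) base bandit algorithm that plays `L` of `K` arms. In its `n`-th round after
initialization it selects `L` arms from its history, which consists of the earlier seeds and
the bandit feedback of the earlier rounds, and from the seed of the current round. (The earlier
selections are determined by this history.) -/
structure BaseBandit (K L : ℕ) where
  act : (n : ℕ) → (Fin n → I × (Fin K → I)) → I → Finset (Fin K)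
  card_act : ∀ n h u, (act n h u).card = L
  measurableSet_act : ∀ n (J : Finset (Fin K)),
    MeasurableSet {p : (Fin n → I × (Fin K → I)) × I | act n p.1 p.2 = J}

/-- The sequence of samples from round `τ` on. -/
def shiftSeq {α : Type*} (τ : ℕ) (z : ℕ → α) : ℕ → α := fun n => z (τ + n)

namespace BaseBandit

variable {K L : ℕ}

/-- The arms that the base bandit, run alone on the samples `z`, selects in round `n`. -/
def play (B : BaseBandit K L) (z : ℕ → I × (Fin K → I)) (n : ℕ) : Finset (Fin K) :=
  B.act n (fun k : Fin n => ((z k).1, feedback (B.play z k) (z k).2)) (z n).1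
termination_by n
decreasing_by exact k.isLt

/-- Strong drift-tolerant regret with factor `c`: in every environment, with probability at least
`1 - 4K/T²`, the regret of the base bandit run alone satisfies
`Reg(S) ≤ c (√(LKS) + L ∑_{t ≤ S} ε(t))` for all `S ∈ [T]`. -/
def StrongDT (B : BaseBandit K L) (T : ℕ) (c : ℝ) : Prop :=
  ∀ E : Environment K,
    1 - 4 * (K : ℝ) / (T : ℝ) ^ 2 ≤ E.sampleMeasure.real
      {z | ∀ S : ℕ, 1 ≤ S → S ≤ T → E.regret L (B.play z) S ≤
        c * (√((L : ℝ) * K * S) + L * ∑ t ∈ Finset.range S, E.drift t)}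

/-- Monitoring consistency with parameter `D`: in every environment, almost surely there is an arm
that the base bandit, run alone for `T` rounds, selects at least once in any `D` consecutive
rounds. -/
def MonitoringConsistent (B : BaseBandit K L) (T D : ℕ) : Prop :=
  ∀ E : Environment K, ∀ᵐ z ∂E.sampleMeasure,
    ∃ i : Fin K, ∀ t : ℕ, t + D ≤ T → ∃ s : ℕ, t ≤ s ∧ s < t + D ∧ i ∈ B.play z s

/-- The rounds in `[m, n)` in which the base bandit, run on `z`, selects arm `i`. -/
def drawn (B : BaseBandit K L) (z : ℕ → I × (Fin K → I)) (i : Fin K) (m n : ℕ) : Finset ℕ :=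
  (Finset.Ico m n).filter fun s => i ∈ B.play z s

/-- The empirical mean of the rewards of arm `i` that were observed in the rounds `[m, n)`. -/
def empMean (B : BaseBandit K L) (z : ℕ → I × (Fin K → I)) (i : Fin K) (m n : ℕ) : ℝ :=
  (∑ s ∈ B.drawn z i m n, ((z s).2 i : ℝ)) / ((B.drawn z i m n).card : ℝ)

/-- A change is detected with confidence level `δ` when the window is `{0, …, n - 1}`: for some arm
and some split into `W₁ = [0, m)` and `W₂ = [m, n)`, both containing observations of this arm, the
empirical means differ by at least
`√(log(1/δ) / (2 |W_{i,1}|)) + √(log(1/δ) / (2 |W_{i,2}|))`. -/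
def Detects (B : BaseBandit K L) (δ : ℝ) (z : ℕ → I × (Fin K → I)) (n : ℕ) : Prop :=
  ∃ i : Fin K, ∃ m : ℕ, m ≤ n ∧ 1 ≤ (B.drawn z i 0 m).card ∧ 1 ≤ (B.drawn z i m n).card ∧
    √(Real.log (1 / δ) / (2 * ((B.drawn z i 0 m).card : ℝ))) +
      √(Real.log (1 / δ) / (2 * ((B.drawn z i m n).card : ℝ))) ≤
    |B.empMean z i 0 m - B.empMean z i m n|

open Classical in
/-- The first round of the window of ADR-bandit at the beginning of round `t`. The window after
round `t` is `{adrStart t, …, t}`; if it contains a change, it is emptied and the base bandit is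
re-initialized. -/
def adrStart (B : BaseBandit K L) (δ : ℝ) (z : ℕ → I × (Fin K → I)) : ℕ → ℕ
  | 0 => 0
  | t + 1 =>
    if B.Detects δ (shiftSeq (B.adrStart δ z t) z) (t + 1 - B.adrStart δ z t) then t + 1
    else B.adrStart δ z t

/-- The arms that ADR-bandit selects in round `t`: those of the base bandit that was initialized
at the beginning of the current window. -/
def adrPlay (B : BaseBandit K L) (δ : ℝ) (z : ℕ → I × (Fin K → I)) (t : ℕ) : Finset (Fin K) :=
  B.play (shiftSeq (B.adrStart δ z t) z) (t - B.adrStart δ z t)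

end BaseBandit

end

/-! Put x = T^(d/3), so that the speed is b = x^(-3) and the target is √(LK)·T/x up to logarithms. A
restart at τ is decided by the rounds before τ, so the later samples are fresh and distributed as in
the shifted environment (`measureReal_inter_shiftSeq`). Two opposite facts about windows of about x²
rounds then balance.

Restarts are rare. Over n₀ ≈ x²/log T rounds the means move by at most n₀b, which is below the
precision of n₀ observations, so a detection within n₀ rounds of a restart has probability at most
1/2 (`measureReal_detects_le`). All other windows but the last have more than n₀ rounds. Hence the
expected number r of windows satisfies r ≤ 1 + T/(n₀+1) + r/2, i.e. r = O(T log T/x²)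
(`expRestarts_le`).

Undetected drift is small. Within D·y rounds, y ≈ x², the monitored arm is observed at least y
times. Without a detection its mean has therefore moved by at most O(log T/x) since the start of the
window (`Monitors.abs_mean_sub_le`), and because changes are global the same holds for every arm up
to the factor 1/C^gr (`drift_le_of_globalChanges`).

On a good window of length l the base bandit thus has regret at most c(√(LKl) + L·l·O(log T/x)). By
√l ≤ (l/x + x)/2 the sum over windows is linear in their number, so only its expectation matters
(`regret_adrPlay_le`). Each restart is followed by a bad window with probability at most 8K/T², at a
cost of at most TL. Both contributions are of the desired order (`integral_regret_adrPlay_le`,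
`regret_budget`). -/

section Glue

variable {K : ℕ}

/-! ### Resampling and shifting of the product measure. -/

namespace Environment

instance (E : Environment K) : IsProbabilityMeasure E.sampleMeasure := by
  unfold sampleMeasure; infer_instance

/-- The environment from round `τ` on. -/
def shift (E : Environment K) (τ : ℕ) : Environment K where
  law t := E.law (τ + t)
  isProb _ := E.isProb _

@[simp] theorem mean_shift (E : Environment K) (τ : ℕ) (i : Fin K) (t : ℕ) :
    (E.shift τ).mean i t = E.mean i (τ + t) := rfl

end Environment

open Classical in
/-- The sequence that follows `z` on `S` and `z'` off `S`. -/
noncomputable def glue {α : Type*} (S : Set ℕ) (q : (ℕ → α) × (ℕ → α)) : ℕ → α :=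
  fun n => if n ∈ S then q.1 n else q.2 n

theorem glue_of_mem {α : Type*} {S : Set ℕ} {n : ℕ} (h : n ∈ S) (q : (ℕ → α) × (ℕ → α)) :
    glue S q n = q.1 n := by simp [glue, h]

theorem glue_of_notMem {α : Type*} {S : Set ℕ} {n : ℕ} (h : n ∉ S) (q : (ℕ → α) × (ℕ → α)) :
    glue S q n = q.2 n := by simp [glue, h]

theorem measurable_glue {α : Type*} [MeasurableSpace α] (S : Set ℕ) :
    Measurable (glue (α := α) S) := by
  refine measurable_pi_lambda _ fun n => ?_
  by_cases h : n ∈ S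
  · simp only [glue, h, if_true]; fun_prop
  · simp only [glue, h, if_false]; fun_prop

theorem measurable_shiftSeq {α : Type*} [MeasurableSpace α] (τ : ℕ) :
    Measurable (shiftSeq (α := α) τ) :=
  measurable_pi_lambda _ fun n => measurable_pi_apply (τ + n)

namespace Environment

/-- Under a product law, coordinates may be replaced by those of an independent copy. Together with
Fubini this plays the role of conditional expectations. -/
theorem measurePreserving_glue (E : Environment K) (S : Set ℕ) :
    MeasurePreserving (glue S) (E.sampleMeasure.prod E.sampleMeasure) E.sampleMeasure := by
  classical
  refine ⟨measurable_glue S, ?_⟩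
  refine Measure.eq_infinitePi _ fun s t ht => ?_
  have hpre : glue S ⁻¹' (Set.pi (s : Set ℕ) t) =
      (Set.pi (s.filter (· ∈ S) : Finset ℕ) t) ×ˢ (Set.pi (s.filter (· ∉ S) : Finset ℕ) t) := by
    ext q
    simp only [Set.mem_preimage, Set.mem_pi, Set.mem_prod, Finset.coe_filter, Set.mem_ofPred_eq,
      Finset.mem_coe]
    constructor
    · intro h
      exact ⟨fun n hn => by simpa [glue, hn.2] using h n hn.1,
        fun n hn => by simpa [glue, hn.2] using h n hn.1⟩
    · rintro ⟨h1, h2⟩ n hn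
      by_cases hS : n ∈ S
      · simpa [glue, hS] using h1 n ⟨hn, hS⟩
      · simpa [glue, hS] using h2 n ⟨hn, hS⟩
  rw [Measure.map_apply (measurable_glue S)
    (MeasurableSet.pi s.countable_toSet fun n _ => ht n), hpre, Measure.prod_prod]
  unfold sampleMeasure
  rw [Measure.infinitePi_pi _ (fun n _ => ht n), Measure.infinitePi_pi _ (fun n _ => ht n),
    Finset.prod_filter_mul_prod_filter_not]

/-- The assumptions on the base bandit hold in every environment, hence in `E.shift τ`; this
transports them to a run initialized in round τ. -/
theorem measurePreserving_shiftSeq (E : Environment K) (τ : ℕ) :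
    MeasurePreserving (shiftSeq τ) E.sampleMeasure (E.shift τ).sampleMeasure := by
  classical
  refine ⟨measurable_shiftSeq τ, ?_⟩
  refine Measure.eq_infinitePi _ fun s t ht => ?_
  have hpre : shiftSeq τ ⁻¹' (Set.pi (s : Set ℕ) t) =
      Set.pi (s.map (addLeftEmbedding τ) : Finset ℕ) (fun n => t (n - τ)) := by
    ext z
    simp [Set.mem_pi, shiftSeq]
  rw [Measure.map_apply (measurable_shiftSeq τ)
    (MeasurableSet.pi s.countable_toSet fun n _ => ht n), hpre]
  unfold sampleMeasure
  rw [Measure.infinitePi_pi _ (fun n _ => ht _), Finset.prod_map]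
  simp [shift]

/-- An event that is determined by the first `τ` rounds is independent of the later rounds. -/
theorem measureReal_inter_shiftSeq (E : Environment K) (τ : ℕ) {P : Set (ℕ → I × (Fin K → I))}
    (hP : MeasurableSet P) (hdep : ∀ z z', (∀ k < τ, z k = z' k) → z ∈ P → z' ∈ P)
    {G : Set (ℕ → I × (Fin K → I))} (hG : MeasurableSet G) :
    E.sampleMeasure.real (P ∩ shiftSeq τ ⁻¹' G) =
      E.sampleMeasure.real P * (E.shift τ).sampleMeasure.real G := by
  have hpre : glue (Set.Iio τ) ⁻¹' (P ∩ shiftSeq τ ⁻¹' G) = P ×ˢ (shiftSeq τ ⁻¹' G) := by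
    ext q
    have h1 : ∀ k < τ, glue (Set.Iio τ) q k = q.1 k := fun k hk =>
      glue_of_mem (Set.mem_Iio.2 hk) q
    have h2 : shiftSeq τ (glue (Set.Iio τ) q) = shiftSeq τ q.2 :=
      funext fun n => glue_of_notMem (by simp) q
    simp only [Set.mem_preimage, Set.mem_inter_iff, Set.mem_prod, h2]
    exact and_congr_left fun _ => ⟨hdep _ _ h1, hdep _ _ fun k hk => (h1 k hk).symm⟩
  have hGm := measurable_shiftSeq τ hG
  rw [← (E.measurePreserving_glue (Set.Iio τ)).measureReal_preimage
    (hP.inter hGm).nullMeasurableSet, hpre, measureReal_prod_prod,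
    (E.measurePreserving_shiftSeq τ).measureReal_preimage hG.nullMeasurableSet]

end Environment

end Glue

/-! ### Causality and measurability of the algorithms. -/

namespace BaseBandit

variable {K L : ℕ} (B : BaseBandit K L)

theorem card_play (z : ℕ → I × (Fin K → I)) (n : ℕ) : (B.play z n).card = L := by
  rw [play]; exact B.card_act _ _ _

/-- Only the seed of the current round enters, not its rewards. This is the source of predictability
in the concentration bounds. -/
theorem play_congr {z z' : ℕ → I × (Fin K → I)} {n : ℕ} (h : ∀ k < n, z k = z' k)
    (hn : (z n).1 = (z' n).1) : B.play z n = B.play z' n := by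
  induction n using Nat.strong_induction_on with
  | _ n ih =>
    rw [play, play, hn]
    congr 1
    funext k
    rw [h k k.isLt, ih k k.isLt (fun j hj => h j (hj.trans k.isLt)) (by rw [h k k.isLt])]

theorem drawn_congr {z z' : ℕ → I × (Fin K → I)} {n : ℕ} (h : ∀ k < n, z k = z' k)
    (i : Fin K) {m l : ℕ} (hl : l ≤ n) : B.drawn z i m l = B.drawn z' i m l := by
  refine Finset.filter_congr fun s hs => ?_
  have hs' := (Finset.mem_Ico.1 hs).2.trans_le hl
  rw [B.play_congr (fun k hk => h k (hk.trans hs')) (by rw [h s hs'])]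

theorem empMean_congr {z z' : ℕ → I × (Fin K → I)} {n : ℕ} (h : ∀ k < n, z k = z' k)
    (i : Fin K) {m l : ℕ} (hl : l ≤ n) : B.empMean z i m l = B.empMean z' i m l := by
  rw [empMean, empMean, B.drawn_congr h i hl]
  congr 1
  refine Finset.sum_congr rfl fun s hs => ?_
  rw [h s ((Finset.mem_Ico.1 (Finset.mem_filter.1 hs).1).2.trans_le hl)]

theorem detects_congr {δ : ℝ} {z z' : ℕ → I × (Fin K → I)} {n : ℕ} (h : ∀ k < n, z k = z' k) :
    B.Detects δ z n ↔ B.Detects δ z' n := by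
  refine exists_congr fun i => exists_congr fun m => and_congr_right fun hm => ?_
  rw [B.drawn_congr h i hm, B.drawn_congr h i le_rfl, B.empMean_congr h i hm,
    B.empMean_congr h i le_rfl]

theorem adrStart_le (δ : ℝ) (z : ℕ → I × (Fin K → I)) (t : ℕ) : B.adrStart δ z t ≤ t := by
  induction t with
  | zero => simp [adrStart]
  | succ t ih => rw [adrStart]; split_ifs <;> omega

/-- Makes a restart in round t independent of the samples from round t on. -/
theorem adrStart_congr {δ : ℝ} {z z' : ℕ → I × (Fin K → I)} {t : ℕ} (h : ∀ k < t, z k = z' k) :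
    B.adrStart δ z t = B.adrStart δ z' t := by
  induction t with
  | zero => simp [adrStart]
  | succ t ih =>
    have hle := B.adrStart_le δ z' t
    rw [adrStart, adrStart, ih fun k hk => h k (by omega)]
    have hiff := B.detects_congr (δ := δ) (z := shiftSeq (B.adrStart δ z' t) z)
      (z' := shiftSeq (B.adrStart δ z' t) z') (n := t + 1 - B.adrStart δ z' t)
      (fun k hk => h _ (by omega))
    by_cases hdet : B.Detects δ (shiftSeq (B.adrStart δ z' t) z') (t + 1 - B.adrStart δ z' t)
    · rw [if_pos hdet, if_pos (hiff.2 hdet)]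
    · rw [if_neg hdet, if_neg (mt hiff.1 hdet)]

theorem measurableSet_play (n : ℕ) (P : Finset (Fin K) → Prop) :
    MeasurableSet {z : ℕ → I × (Fin K → I) | P (B.play z n)} := by
  suffices h : ∀ J, MeasurableSet {z : ℕ → I × (Fin K → I) | B.play z n = J} by
    have : {z : ℕ → I × (Fin K → I) | P (B.play z n)} = ⋃ J ∈ {J | P J}, {z | B.play z n = J} := by
      ext z; simp
    rw [this]
    exact MeasurableSet.biUnion (Set.to_countable _) fun J _ => h J
  intro J
  induction n using Nat.strong_induction_on generalizing J with
  | _ n ih =>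
    have hm : Measurable fun z : ℕ → I × (Fin K → I) =>
        ((fun k : Fin n => ((z k).1, feedback (B.play z k) (z k).2)), (z n).1) := by
      refine Measurable.prodMk (measurable_pi_lambda _ fun k => ?_) (by fun_prop)
      refine Measurable.prodMk (by fun_prop) (measurable_pi_lambda _ fun i => ?_)
      refine Measurable.ite ?_ (by fun_prop) measurable_const
      have : {z : ℕ → I × (Fin K → I) | i ∈ B.play z k} =
          ⋃ J ∈ {J : Finset (Fin K) | i ∈ J}, {z | B.play z k = J} := by
        ext z; simp
      rw [this]
      exact MeasurableSet.biUnion (Set.to_countable _) fun J _ => ih k k.isLt J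
    have heq : {z : ℕ → I × (Fin K → I) | B.play z n = J} =
        (fun z : ℕ → I × (Fin K → I) =>
          ((fun k : Fin n => ((z k).1, feedback (B.play z k) (z k).2)), (z n).1)) ⁻¹'
          {q | B.act n q.1 q.2 = J} := by
      ext z
      simp only [Set.mem_ofPred_eq, Set.mem_preimage]
      rw [play]
    rw [heq]
    exact hm (B.measurableSet_act n J)

theorem measurable_sum_drawn (i : Fin K) (m n : ℕ) (f : ℕ → (ℕ → I × (Fin K → I)) → ℝ)
    (hf : ∀ s, Measurable (f s)) :
    Measurable fun z : ℕ → I × (Fin K → I) => ∑ s ∈ B.drawn z i m n, f s z := by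
  simp only [drawn, Finset.sum_filter]
  refine Finset.measurable_sum _ fun s _ => ?_
  exact Measurable.ite (B.measurableSet_play s fun J => i ∈ J) (hf s) measurable_const

theorem measurable_card_drawn (i : Fin K) (m n : ℕ) :
    Measurable fun z : ℕ → I × (Fin K → I) => (B.drawn z i m n).card := by
  simp only [drawn, Finset.card_filter]
  refine Finset.measurable_sum _ fun s _ => ?_
  exact Measurable.ite (B.measurableSet_play s fun J => i ∈ J) measurable_const measurable_const

theorem measurable_empMean (i : Fin K) (m n : ℕ) :
    Measurable fun z : ℕ → I × (Fin K → I) => B.empMean z i m n := by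
  refine Measurable.div (B.measurable_sum_drawn i m n _ fun s => by fun_prop) ?_
  exact measurable_from_nat.comp (B.measurable_card_drawn i m n)

theorem measurableSet_detects (δ : ℝ) (n : ℕ) :
    MeasurableSet {z : ℕ → I × (Fin K → I) | B.Detects δ z n} := by
  have hc := fun i m n => B.measurable_card_drawn i m n
  have hc' : ∀ i m n, Measurable fun z : ℕ → I × (Fin K → I) => ((B.drawn z i m n).card : ℝ) :=
    fun i m n => measurable_from_nat.comp (hc i m n)
  have he := fun i m n => B.measurable_empMean i m n
  simp only [Detects, Set.ofPred_exists, Set.ofPred_and]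
  refine MeasurableSet.iUnion fun i => MeasurableSet.iUnion fun m => ?_
  refine (MeasurableSet.const _).inter ((measurableSet_le measurable_const (hc _ _ _)).inter
    ((measurableSet_le measurable_const (hc _ _ _)).inter (measurableSet_le ?_ ?_)))
  · have h1 := hc' i 0 m
    have h2 := hc' i m n
    fun_prop
  · have h1 := he i 0 m
    have h2 := he i m n
    exact measurable_norm.comp (h1.sub h2)

theorem measurable_adrStart (δ : ℝ) (t : ℕ) :
    Measurable fun z : ℕ → I × (Fin K → I) => B.adrStart δ z t := by
  induction t with
  | zero => simp only [adrStart]; exact measurable_const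
  | succ t ih =>
    simp only [adrStart]
    refine Measurable.ite ?_ measurable_const ih
    have : {z : ℕ → I × (Fin K → I) |
        B.Detects δ (shiftSeq (B.adrStart δ z t) z) (t + 1 - B.adrStart δ z t)} =
        ⋃ τ : ℕ, {z | B.adrStart δ z t = τ} ∩
          shiftSeq τ ⁻¹' {z | B.Detects δ z (t + 1 - τ)} := by
      ext z; simp
    rw [this]
    exact MeasurableSet.iUnion fun τ => (ih (measurableSet_singleton τ)).inter
      (measurable_shiftSeq τ (B.measurableSet_detects δ _))

theorem measurableSet_adrPlay (δ : ℝ) (t : ℕ) (P : Finset (Fin K) → Prop) :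
    MeasurableSet {z : ℕ → I × (Fin K → I) | P (B.adrPlay δ z t)} := by
  have : {z : ℕ → I × (Fin K → I) | P (B.adrPlay δ z t)} =
      ⋃ τ : ℕ, {z | B.adrStart δ z t = τ} ∩ shiftSeq τ ⁻¹' {z | P (B.play z (t - τ))} := by
    ext z; simp [adrPlay]
  rw [this]
  exact MeasurableSet.iUnion fun τ => ((B.measurable_adrStart δ t) (measurableSet_singleton τ)).inter
    (measurable_shiftSeq τ (B.measurableSet_play _ P))

end BaseBandit

/-! ### Hoeffding's inequality for predictable selections of rounds. -/

section Concentration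

variable {K : ℕ}

/-- Membership of a round in the random set given by `V` is decided before the rewards of this
round are observed. -/
structure IsPredictable (V : ℕ → Set (ℕ → I × (Fin K → I))) : Prop where
  measurableSet : ∀ s, MeasurableSet (V s)
  congr : ∀ s z z', (∀ k < s, z k = z' k) → (z s).1 = (z' s).1 → z ∈ V s → z' ∈ V s

/-- The number of rounds before `M` in the random set given by `V`. -/
noncomputable def selCount (V : ℕ → Set (ℕ → I × (Fin K → I))) (M : ℕ)
    (z : ℕ → I × (Fin K → I)) : ℝ :=
  ∑ s ∈ Finset.range M, (V s).indicator (fun _ => (1 : ℝ)) z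

namespace Environment

variable (E : Environment K)

/-- The accumulated deviation of the rewards of arm `i` from their means over the rounds before `M`
in the random set given by `V`. -/
noncomputable def selNoise (V : ℕ → Set (ℕ → I × (Fin K → I))) (i : Fin K) (M : ℕ)
    (z : ℕ → I × (Fin K → I)) : ℝ :=
  ∑ s ∈ Finset.range M, (V s).indicator (fun z => ((z s).2 i : ℝ) - E.mean i s) z

variable {E} {V : ℕ → Set (ℕ → I × (Fin K → I))}

theorem _root_.IsPredictable.measurable_selCount (hV : IsPredictable V) (M : ℕ) :
    Measurable (selCount V M) :=
  Finset.measurable_sum _ fun s _ => measurable_const.indicator (hV.measurableSet s)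

theorem _root_.IsPredictable.measurable_selNoise (hV : IsPredictable V) (i : Fin K) (M : ℕ) :
    Measurable (E.selNoise V i M) := by
  refine Finset.measurable_sum _ fun s _ => Measurable.indicator ?_ (hV.measurableSet s)
  fun_prop

/-- Hoeffding's lemma: a variable in an interval of length 1 is sub-Gaussian with variance proxy
1/4. -/
theorem lintegral_exp_reward_le (E : Environment K) (i : Fin K) (t : ℕ) (l : ℝ) :
    ∫⁻ x, ENNReal.ofReal (Real.exp (l * ((x i : ℝ) - E.mean i t) - l ^ 2 / 8)) ∂(E.law t) ≤ 1 := by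
  have hsub := ProbabilityTheory.hasSubgaussianMGF_of_mem_Icc (μ := E.law t) (a := 0) (b := 1)
    (X := fun x : Fin K → I => (x i : ℝ))
    (measurable_subtype_coe.comp (measurable_pi_apply i)).aemeasurable
    (Filter.Eventually.of_forall fun x => (x i).2)
  have hle := hsub.mgf_le l
  have hint := hsub.integrable_exp_mul l
  have heq : ∀ x : Fin K → I, Real.exp (l * ((x i : ℝ) - E.mean i t) - l ^ 2 / 8) =
      Real.exp (l * ((x i : ℝ) - ∫ x, (x i : ℝ) ∂(E.law t))) * Real.exp (-(l ^ 2 / 8)) := by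
    intro x
    rw [← Real.exp_add, mean]; ring_nf
  simp_rw [heq]
  rw [← ofReal_integral_eq_lintegral_ofReal (hint.mul_const _)
    (Filter.Eventually.of_forall fun x => by positivity), integral_mul_const]
  refine ENNReal.ofReal_le_one.2 ?_
  rw [ProbabilityTheory.mgf] at hle
  refine (mul_le_mul_of_nonneg_right hle (by positivity)).trans ?_
  rw [← Real.exp_add]
  refine (Real.exp_le_exp.2 (le_of_eq ?_)).trans_eq Real.exp_zero
  simp
  ring

/-- The integrand is a supermartingale in M: each new factor has conditional mean at most 1, since
it is trivial unless the round is selected, and the selection is known before the reward. -/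
theorem lintegral_exp_selNoise_le (hV : IsPredictable V) (i : Fin K) (l : ℝ) (M : ℕ) :
    ∫⁻ z, ENNReal.ofReal (Real.exp (l * E.selNoise V i M z - l ^ 2 / 8 * selCount V M z))
      ∂E.sampleMeasure ≤ 1 := by
  classical
  induction M with
  | zero => simp [selNoise, selCount]
  | succ M ih =>
    set F : (ℕ → I × (Fin K → I)) → ENNReal := fun z =>
      ENNReal.ofReal (Real.exp (l * E.selNoise V i M z - l ^ 2 / 8 * selCount V M z)) with hF
    set H : (ℕ → I × (Fin K → I)) → ENNReal := fun z => ENNReal.ofReal (Real.exp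
      ((V M).indicator (fun z => l * (((z M).2 i : ℝ) - E.mean i M) - l ^ 2 / 8) z)) with hH
    have hFm : Measurable F := by
      have h1 := hV.measurable_selNoise (E := E) i M
      have h2 := hV.measurable_selCount M
      fun_prop
    have hHm : Measurable H := by
      have : Measurable ((V M).indicator
          (fun z : ℕ → I × (Fin K → I) => l * (((z M).2 i : ℝ) - E.mean i M) - l ^ 2 / 8)) :=
        Measurable.indicator (by fun_prop) (hV.measurableSet M)
      fun_prop
    have hsucc : ∀ z, ENNReal.ofReal (Real.exp
        (l * E.selNoise V i (M + 1) z - l ^ 2 / 8 * selCount V (M + 1) z)) = F z * H z := by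
      intro z
      rw [hF, hH]
      simp only
      rw [← ENNReal.ofReal_mul (by positivity), ← Real.exp_add]
      congr 2
      rw [selNoise, selCount, Finset.sum_range_succ, Finset.sum_range_succ]
      simp only [Set.indicator]
      split_ifs
      · rw [selNoise, selCount]; simp only [Set.indicator]; ring
      · rw [selNoise, selCount]; simp only [Set.indicator]; ring
    simp_rw [hsucc]
    -- Only coordinate M is resampled. The old product `F` ignores this coordinate, so it leaves the
    -- inner integral.
    have hglue := E.measurePreserving_glue {M}ᶜ
    have hFH : Measurable fun z => F z * H z := hFm.mul hHm
    have hFHg : Measurable fun a => F (glue {M}ᶜ a) * H (glue {M}ᶜ a) :=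
      hFH.comp hglue.measurable
    rw [← hglue.lintegral_comp hFH, lintegral_prod _ hFHg.aemeasurable]
    refine le_trans (lintegral_mono fun z => ?_) ih
    have hup : ∀ z', glue {M}ᶜ (z, z') = Function.update z M (z' M) := by
      intro z'
      funext n
      by_cases hn : n = M
      · subst hn; simp [glue]
      · simp [glue, hn]
    have hFz : ∀ y, F (Function.update z M y) = F z := by
      intro y
      have hne : ∀ s < M, ∀ k ≤ s, Function.update z M y k = z k := fun s hs k hk =>
        Function.update_of_ne (by omega) _ _
      have hmem : ∀ s < M, (Function.update z M y ∈ V s ↔ z ∈ V s) := fun s hs =>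
        ⟨hV.congr s _ _ (fun k hk => hne s hs k hk.le) (by rw [hne s hs s le_rfl]),
          hV.congr s _ _ (fun k hk => (hne s hs k hk.le).symm) (by rw [hne s hs s le_rfl])⟩
      have h1 : E.selNoise V i M (Function.update z M y) = E.selNoise V i M z := by
        refine Finset.sum_congr rfl fun s hs => ?_
        have hs := Finset.mem_range.1 hs
        simp only [Set.indicator, hmem s hs, hne s hs s le_rfl]
      have h2 : selCount V M (Function.update z M y) = selCount V M z := by
        refine Finset.sum_congr rfl fun s hs => ?_
        have hs := Finset.mem_range.1 hs
        simp only [Set.indicator, hmem s hs]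
      simp only [hF, h1, h2]
    simp_rw [hup, hFz]
    have hHu : Measurable fun y => H (Function.update z M y) :=
      hHm.comp (measurable_update z)
    have hHuM : Measurable fun y : ℕ → I × (Fin K → I) => H (Function.update z M (y M)) :=
      hHu.comp (measurable_pi_apply M)
    rw [lintegral_const_mul _ hHuM]
    refine mul_le_of_le_one_right' ?_
    have hev := measurePreserving_eval_infinitePi
      (fun t => (volume : Measure I).prod (E.law t)) M
    have hstep := hev.lintegral_comp hHu
    simp only [Function.eval] at hstep
    rw [sampleMeasure, hstep, lintegral_prod _ hHu.aemeasurable]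
    refine le_trans (lintegral_mono fun u => ?_) (lintegral_const (1 : ENNReal)).le |>.trans ?_
    · by_cases hu : Function.update z M (u, 0) ∈ V M
      · have hux : ∀ x, Function.update z M (u, x) ∈ V M := fun x => by
          refine hV.congr M _ _ (fun k hk => ?_) (by simp) hu
          rw [Function.update_of_ne hk.ne, Function.update_of_ne hk.ne]
        simp only [hH, Set.indicator, hux, if_true, Function.update_self]
        exact E.lintegral_exp_reward_le i M l
      · have hux : ∀ x, Function.update z M (u, x) ∉ V M := fun x hx => by
          refine hu (hV.congr M _ _ (fun k hk => ?_) (by simp) hx)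
          rw [Function.update_of_ne hk.ne, Function.update_of_ne hk.ne]
        simp [hH, Set.indicator, hux]
    · simp

theorem measureReal_selNoise_ge_le (hV : IsPredictable V) (i : Fin K) (M : ℕ) (l r : ℝ) :
    E.sampleMeasure.real
      {z | r ≤ l * E.selNoise V i M z - l ^ 2 / 8 * selCount V M z} ≤ Real.exp (-r) := by
  have h1 := hV.measurable_selNoise (E := E) i M
  have h2 := hV.measurable_selCount M
  have hm := mul_meas_ge_le_lintegral (μ := E.sampleMeasure) (f := fun z =>
    ENNReal.ofReal (Real.exp (l * E.selNoise V i M z - l ^ 2 / 8 * selCount V M z)))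
    (by fun_prop) (ENNReal.ofReal (Real.exp r))
  have hm' := hm.trans (lintegral_exp_selNoise_le hV i l M)
  have hset : {z | ENNReal.ofReal (Real.exp r) ≤ ENNReal.ofReal
      (Real.exp (l * E.selNoise V i M z - l ^ 2 / 8 * selCount V M z))} =
      {z | r ≤ l * E.selNoise V i M z - l ^ 2 / 8 * selCount V M z} := by
    ext z
    simp only [Set.mem_ofPred_eq]
    rw [ENNReal.ofReal_le_ofReal_iff (Real.exp_nonneg _), Real.exp_le_exp]
  rw [hset] at hm'
  have := ENNReal.toReal_mono ENNReal.one_ne_top hm'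
  rw [ENNReal.toReal_mul, ENNReal.toReal_ofReal (Real.exp_nonneg _), ENNReal.toReal_one] at this
  rw [Real.exp_neg, ← one_div, le_div_iff₀ (Real.exp_pos _), mul_comm]
  exact this

/-- Hoeffding's inequality for a predictable selection of at most `N` rounds. -/
theorem measureReal_abs_selNoise_ge_le (hV : IsPredictable V) (i : Fin K) (M : ℕ) {l : ℝ}
    (hl : 0 ≤ l) (a N : ℝ) :
    E.sampleMeasure.real {z | a ≤ |E.selNoise V i M z| ∧ selCount V M z ≤ N} ≤
      2 * Real.exp (-(l * a) + l ^ 2 / 8 * N) := by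
  have h1 := measureReal_selNoise_ge_le (E := E) hV i M l (l * a - l ^ 2 / 8 * N)
  have h2 := measureReal_selNoise_ge_le (E := E) hV i M (-l) (l * a - l ^ 2 / 8 * N)
  refine (measureReal_mono (s₂ := {z | l * a - l ^ 2 / 8 * N ≤
    l * E.selNoise V i M z - l ^ 2 / 8 * selCount V M z} ∪ {z | l * a - l ^ 2 / 8 * N ≤
    -l * E.selNoise V i M z - (-l) ^ 2 / 8 * selCount V M z}) ?_).trans
      ((measureReal_union_le _ _).trans ?_)
  · rintro z ⟨hz, hN⟩
    have hN' : l ^ 2 / 8 * selCount V M z ≤ l ^ 2 / 8 * N :=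
      mul_le_mul_of_nonneg_left hN (by positivity)
    rcases le_abs'.1 hz with h | h
    · right
      have := mul_le_mul_of_nonneg_left h hl
      simp only [Set.mem_ofPred_eq, neg_sq]
      linarith
    · left
      have := mul_le_mul_of_nonneg_left h hl
      simp only [Set.mem_ofPred_eq]
      linarith
  · rw [show -(l * a) + l ^ 2 / 8 * N = -(l * a - l ^ 2 / 8 * N) by ring]
    linarith

end Environment

end Concentration

/-! ### Noise in windows of observations, and false alarms soon after a restart. -/

section Windows

variable {K L : ℕ}

theorem selCount_eq_card {V : ℕ → Set (ℕ → I × (Fin K → I))} {M : ℕ} {W : Finset ℕ}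
    {z : ℕ → I × (Fin K → I)} (hW : W ⊆ Finset.range M) (h : ∀ s < M, z ∈ V s ↔ s ∈ W) :
    selCount V M z = W.card := by
  classical
  have : W = (Finset.range M).filter fun s => z ∈ V s := by
    ext s
    rw [Finset.mem_filter, Finset.mem_range]
    exact ⟨fun hs => ⟨Finset.mem_range.1 (hW hs), (h s (Finset.mem_range.1 (hW hs))).2 hs⟩,
      fun hs => (h s hs.1).1 hs.2⟩
  rw [this, selCount, Finset.card_filter, Nat.cast_sum]
  exact Finset.sum_congr rfl fun s _ => by simp [Set.indicator]

namespace Environment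

variable (E : Environment K)

theorem selNoise_eq_sum {V : ℕ → Set (ℕ → I × (Fin K → I))} {i : Fin K} {M : ℕ} {W : Finset ℕ}
    {z : ℕ → I × (Fin K → I)} (hW : W ⊆ Finset.range M) (h : ∀ s < M, z ∈ V s ↔ s ∈ W) :
    E.selNoise V i M z = ∑ s ∈ W, (((z s).2 i : ℝ) - E.mean i s) := by
  classical
  have : W = (Finset.range M).filter fun s => z ∈ V s := by
    ext s
    rw [Finset.mem_filter, Finset.mem_range]
    exact ⟨fun hs => ⟨Finset.mem_range.1 (hW hs), (h s (Finset.mem_range.1 (hW hs))).2 hs⟩,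
      fun hs => (h s hs.1).1 hs.2⟩
  rw [this, selNoise, Finset.sum_filter]
  exact Finset.sum_congr rfl fun s _ => by simp [Set.indicator]

theorem Gradual.abs_mean_sub_le {E : Environment K} {T : ℕ} {b : ℝ} (h : E.Gradual T b)
    (i : Fin K) {s t : ℕ} (hst : s ≤ t) (ht : t < T) :
    |E.mean i t - E.mean i s| ≤ ((t : ℝ) - s) * b := by
  induction t, hst using Nat.le_induction with
  | base => simp
  | succ t hst ih =>
    have h1 := ih (by omega)
    have h2 := h i t ht
    have := abs_sub_le (E.mean i (t + 1)) (E.mean i t) (E.mean i s)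
    push_cast
    linarith

theorem Gradual.mono {E : Environment K} {T T' : ℕ} {b : ℝ} (h : E.Gradual T b) (hT : T' ≤ T) :
    E.Gradual T' b := fun i t ht => h i t (ht.trans_le hT)

theorem Gradual.shift {E : Environment K} {T : ℕ} {b : ℝ} (h : E.Gradual T b) (τ : ℕ) :
    (E.shift τ).Gradual (T - τ) b := fun i t ht => h i (τ + t) (by omega)

theorem GlobalChanges.shift {E : Environment K} {T : ℕ} {c : ℝ} (h : E.GlobalChanges T c)
    (τ : ℕ) : (E.shift τ).GlobalChanges (T - τ) c :=
  fun i j s t hs ht => h i j (τ + s) (τ + t) (by omega) (by omega)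

end Environment

namespace BaseBandit

variable (B : BaseBandit K L) (E : Environment K)

/-- The deviation of the rewards of arm `i` observed in the rounds `[m, n)` from their means. -/
noncomputable def windowNoise (z : ℕ → I × (Fin K → I)) (i : Fin K) (m n : ℕ) : ℝ :=
  ∑ s ∈ B.drawn z i m n, (((z s).2 i : ℝ) - E.mean i s)

theorem abs_empMean_sub_le {z : ℕ → I × (Fin K → I)} {i : Fin K} {m n : ℕ} {v Δ : ℝ}
    (hN : 1 ≤ (B.drawn z i m n).card) (hv : ∀ s, m ≤ s → s < n → |E.mean i s - v| ≤ Δ) :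
    |B.empMean z i m n - v| ≤ |B.windowNoise E z i m n| / (B.drawn z i m n).card + Δ := by
  have hpos : (0 : ℝ) < (B.drawn z i m n).card := by exact_mod_cast hN
  have hdrift : |∑ s ∈ B.drawn z i m n, (E.mean i s - v)| ≤ (B.drawn z i m n).card * Δ := by
    refine (Finset.abs_sum_le_sum_abs _ _).trans ?_
    rw [← nsmul_eq_mul]
    refine Finset.sum_le_card_nsmul _ _ _ fun s hs => ?_
    have := Finset.mem_Ico.1 (Finset.mem_filter.1 hs).1
    exact hv s this.1 this.2
  have heq : B.empMean z i m n - v = (B.windowNoise E z i m n +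
      ∑ s ∈ B.drawn z i m n, (E.mean i s - v)) / (B.drawn z i m n).card := by
    rw [empMean, windowNoise, ← Finset.sum_add_distrib, eq_div_iff hpos.ne', sub_mul,
      div_mul_cancel₀ _ hpos.ne']
    simp only [sub_add_sub_cancel, Finset.sum_sub_distrib, Finset.sum_const, nsmul_eq_mul]
    ring
  rw [heq, abs_div, abs_of_pos hpos, div_le_iff₀ hpos, add_mul, div_mul_cancel₀ _ hpos.ne']
  refine (abs_add_le _ _).trans ?_
  linarith

/-- The rounds from the `a`-th to before the `(a + N)`-th observation of arm `i`. -/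
def drawRange (i : Fin K) (a N s : ℕ) : Set (ℕ → I × (Fin K → I)) :=
  {z | i ∈ B.play z s ∧ a ≤ (B.drawn z i 0 s).card ∧ (B.drawn z i 0 s).card < a + N}

theorem isPredictable_drawRange (i : Fin K) (a N : ℕ) : IsPredictable (B.drawRange i a N) where
  measurableSet s := by
    have h := B.measurable_card_drawn i 0 s
    exact (B.measurableSet_play s fun J => i ∈ J).inter
      ((measurableSet_le measurable_const h).inter (measurableSet_lt h measurable_const))
  congr s z z' h h' hz := by
    simp only [drawRange, Set.mem_ofPred_eq] at hz ⊢
    rwa [← B.play_congr h h', ← B.drawn_congr h i le_rfl]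

/-- The rounds from `m` on in which arm `i` is selected. -/
def drawFrom (i : Fin K) (m s : ℕ) : Set (ℕ → I × (Fin K → I)) :=
  {z | i ∈ B.play z s ∧ m ≤ s}

theorem isPredictable_drawFrom (i : Fin K) (m : ℕ) : IsPredictable (B.drawFrom i m) where
  measurableSet s := (B.measurableSet_play s fun J => i ∈ J).inter (MeasurableSet.const _)
  congr s z z' h h' hz := by
    simp only [drawFrom, Set.mem_ofPred_eq] at hz ⊢
    rwa [← B.play_congr h h']

theorem mem_drawFrom_iff (z : ℕ → I × (Fin K → I)) (i : Fin K) (m n s : ℕ) (hs : s < n) :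
    z ∈ B.drawFrom i m s ↔ s ∈ B.drawn z i m n := by
  simp only [drawFrom, drawn, Set.mem_ofPred_eq, Finset.mem_filter, Finset.mem_Ico]
  tauto

theorem drawn_subset_range (z : ℕ → I × (Fin K → I)) (i : Fin K) {m n M : ℕ} (h : n ≤ M) :
    B.drawn z i m n ⊆ Finset.range M := fun s hs => by
  have := Finset.mem_Ico.1 (Finset.mem_filter.1 hs).1
  exact Finset.mem_range.2 (by omega)

theorem drawn_union (z : ℕ → I × (Fin K → I)) (i : Fin K) {l m n : ℕ} (hlm : l ≤ m)
    (hmn : m ≤ n) : B.drawn z i l n = B.drawn z i l m ∪ B.drawn z i m n := by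
  simp only [drawn]
  rw [← Finset.filter_union, Finset.Ico_union_Ico_eq_Ico hlm hmn]

theorem drawn_disjoint (z : ℕ → I × (Fin K → I)) (i : Fin K) (l m n : ℕ) :
    Disjoint (B.drawn z i l m) (B.drawn z i m n) :=
  Finset.disjoint_filter_filter (Finset.Ico_disjoint_Ico_consecutive l m n)

theorem card_drawn_add (z : ℕ → I × (Fin K → I)) (i : Fin K) {l m n : ℕ} (hlm : l ≤ m)
    (hmn : m ≤ n) :
    (B.drawn z i l n).card = (B.drawn z i l m).card + (B.drawn z i m n).card := by
  rw [B.drawn_union z i hlm hmn, Finset.card_union_of_disjoint (B.drawn_disjoint z i l m n)]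

theorem card_drawn_le (z : ℕ → I × (Fin K → I)) (i : Fin K) (m n : ℕ) :
    (B.drawn z i m n).card ≤ n - m :=
  (Finset.card_filter_le _ _).trans_eq (Nat.card_Ico m n)

theorem card_drawn_succ (z : ℕ → I × (Fin K → I)) (i : Fin K) {s : ℕ} (h : i ∈ B.play z s) :
    (B.drawn z i s (s + 1)).card = 1 := by
  simp [drawn, Finset.filter_singleton, h]

/-- Windows are re-indexed by the running number of observations. For fixed a and N the selection is
predictable and the threshold deterministic, so a union bound over the pairs (a, N) covers all
splits. -/
theorem mem_drawRange_iff (z : ℕ → I × (Fin K → I)) (i : Fin K) {m n : ℕ} (hmn : m ≤ n) (s : ℕ) :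
    z ∈ B.drawRange i (B.drawn z i 0 m).card (B.drawn z i m n).card s ↔
      s ∈ B.drawn z i m n := by
  have hadd := B.card_drawn_add z i (Nat.zero_le m) hmn
  simp only [drawRange, Set.mem_ofPred_eq]
  rw [show s ∈ B.drawn z i m n ↔ i ∈ B.play z s ∧ m ≤ s ∧ s < n by
    simp only [drawn, Finset.mem_filter, Finset.mem_Ico]; tauto]
  refine and_congr_right fun hs => ?_
  have h1 := B.card_drawn_add z i (Nat.zero_le s) (Nat.le_succ s)
  rw [Nat.succ_eq_add_one, B.card_drawn_succ z i hs] at h1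
  refine and_congr ?_ ?_
  · constructor
    · intro h
      by_contra! hlt
      have h2 := B.card_drawn_add z i (Nat.zero_le (s + 1)) (show s + 1 ≤ m by omega)
      omega
    · intro h
      have h2 := B.card_drawn_add z i (Nat.zero_le m) h
      omega
  · rw [← hadd]
    constructor
    · intro h
      by_contra! hlt
      have h2 := B.card_drawn_add z i (Nat.zero_le n) hlt
      omega
    · intro h
      have h2 := B.card_drawn_add z i (Nat.zero_le (s + 1)) (show s + 1 ≤ n by omega)
      omega

/-- The event that the observations of arm `i` from the `a`-th to before the `(a + N)`-th within
`M` rounds deviate from their means by at least `c`. -/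
def drawDeviation (i : Fin K) (M a N : ℕ) (c : ℝ) : Set (ℕ → I × (Fin K → I)) :=
  {z | c ≤ |E.selNoise (B.drawRange i a N) i M z| ∧ selCount (B.drawRange i a N) M z ≤ N}

/-- Both empirical means are compared with the initial mean of the arm, from which the true means
differ by at most M·b. If they are further apart than the sum of the two radii, then in one of the
windows the noise exceeds the radius minus M·b. -/
theorem exists_drawDeviation_of_detects {E : Environment K} {M n : ℕ} {b δ : ℝ} (hb : 0 ≤ b)
    (hE : E.Gradual M b) (hn : n ≤ M) {z : ℕ → I × (Fin K → I)} (hz : B.Detects δ z n) :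
    ∃ i : Fin K, ∃ a < M, ∃ N ∈ Finset.Icc 1 M, z ∈ B.drawDeviation E i M a N
      (N * (√(Real.log (1 / δ) / (2 * N)) - M * b)) := by
  obtain ⟨i, m, hmn, h1, h2, hle⟩ := hz
  have hc1 := B.card_drawn_le z i 0 m
  have hc2 := B.card_drawn_le z i m n
  have hv : ∀ s, s < n → |E.mean i s - E.mean i 0| ≤ M * b := fun s hs => by
    refine (hE.abs_mean_sub_le i (Nat.zero_le s) (by omega)).trans ?_
    have : (s : ℝ) ≤ M := by exact_mod_cast (by omega : s ≤ M)
    simp only [Nat.cast_zero, sub_zero]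
    gcongr
  have e1 := B.abs_empMean_sub_le E h1 (v := E.mean i 0) (Δ := M * b) fun s _ hs => hv s (by omega)
  have e2 := B.abs_empMean_sub_le E h2 (v := E.mean i 0) (Δ := M * b) fun s _ hs => hv s hs
  have hsub : ∀ {l r : ℕ}, r ≤ n → B.drawn z i l r ⊆ Finset.range M := fun h =>
    B.drawn_subset_range z i (h.trans hn)
  have key : ∀ {l r : ℕ}, r ≤ n → l ≤ r → 1 ≤ (B.drawn z i l r).card →
      √(Real.log (1 / δ) / (2 * ((B.drawn z i l r).card : ℝ))) - M * b ≤
        |B.windowNoise E z i l r| / (B.drawn z i l r).card →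
      z ∈ B.drawDeviation E i M (B.drawn z i 0 l).card (B.drawn z i l r).card
        ((B.drawn z i l r).card *
          (√(Real.log (1 / δ) / (2 * ((B.drawn z i l r).card : ℝ))) - M * b)) := by
    intro l r hr hlr hN h
    have hpos : (0 : ℝ) < (B.drawn z i l r).card := by exact_mod_cast hN
    have hiff := fun s (_ : s < M) => B.mem_drawRange_iff z i hlr s
    refine ⟨?_, ?_⟩
    · rw [E.selNoise_eq_sum (hsub hr) hiff, mul_comm]
      exact (le_div_iff₀ hpos).1 h
    · rw [selCount_eq_card (hsub hr) hiff]
  have habs := abs_sub_le (B.empMean z i 0 m) (E.mean i 0) (B.empMean z i m n)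
  rw [abs_sub_comm (E.mean i 0)] at habs
  by_cases hcase : √(Real.log (1 / δ) / (2 * ((B.drawn z i 0 m).card : ℝ))) - M * b ≤
        |B.windowNoise E z i 0 m| / (B.drawn z i 0 m).card
  · exact ⟨i, (B.drawn z i 0 0).card, by simp [drawn]; omega, (B.drawn z i 0 m).card,
      Finset.mem_Icc.2 ⟨h1, by omega⟩, key hmn (Nat.zero_le m) h1 hcase⟩
  · exact ⟨i, (B.drawn z i 0 m).card, by omega, (B.drawn z i m n).card,
      Finset.mem_Icc.2 ⟨h2, by omega⟩, key le_rfl hmn h2 (by linarith)⟩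

theorem measureReal_drawDeviation_le (i : Fin K) {M a N : ℕ} {b ρ : ℝ} (hρ : 0 ≤ ρ)
    (hM : 8 * ρ * M ^ 3 * b ^ 2 ≤ 1) (hN : N ∈ Finset.Icc 1 M) :
    E.sampleMeasure.real (B.drawDeviation E i M a N (N * (√(ρ / (2 * N)) - M * b))) ≤
      2 * Real.exp (1 - ρ) := by
  obtain ⟨h1, h2⟩ := Finset.mem_Icc.1 hN
  have hpos : (0 : ℝ) < N := by exact_mod_cast h1
  have hNM : (N : ℝ) ≤ M := by exact_mod_cast h2
  set w := √(ρ / (2 * N)) with hw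
  have hw0 : 0 ≤ w := Real.sqrt_nonneg _
  have hw2 : w ^ 2 * (2 * N) = ρ := by
    rw [hw, Real.sq_sqrt (by positivity), div_mul_cancel₀ _ (by positivity)]
  -- The parameter 4w is optimal for the deviation N·w without drift and yields the exponent −ρ. By
  -- `hM` the drift adds at most 1 to it.
  refine (Environment.measureReal_abs_selNoise_ge_le (B.isPredictable_drawRange i a N) i M
    (l := 4 * w) (by positivity) _ _).trans ?_
  have hsmall : 4 * w * N * (M * b) ≤ 1 := by
    refine abs_le_of_sq_le_sq' ?_ zero_le_one |>.2
    calc (4 * w * N * (M * b)) ^ 2 = 8 * (w ^ 2 * (2 * N)) * (N * M ^ 2) * b ^ 2 := by ring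
      _ ≤ 8 * ρ * (M * M ^ 2) * b ^ 2 := by rw [hw2]; gcongr
      _ ≤ 1 ^ 2 := by rw [one_pow]; linarith
  refine mul_le_mul_of_nonneg_left (Real.exp_le_exp.2 ?_) zero_le_two
  calc -(4 * w * (N * (w - M * b))) + (4 * w) ^ 2 / 8 * N
      = 4 * w * N * (M * b) - w ^ 2 * (2 * N) := by ring
    _ ≤ 1 - ρ := by rw [hw2]; linarith

/-- In a gradually changing environment a restart within few rounds is unlikely. -/
theorem measureReal_detects_le {E : Environment K} {M : ℕ} {b δ : ℝ} (hb : 0 ≤ b)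
    (hE : E.Gradual M b) (hρ : 0 ≤ Real.log (1 / δ)) (hM : 8 * Real.log (1 / δ) * M ^ 3 * b ^ 2 ≤ 1) :
    E.sampleMeasure.real {z | ∃ n ≤ M, B.Detects δ z n} ≤
      K * M ^ 2 * (2 * Real.exp (1 - Real.log (1 / δ))) := by
  have hsub : {z | ∃ n ≤ M, B.Detects δ z n} ⊆
      ⋃ q ∈ (Finset.univ : Finset (Fin K)) ×ˢ (Finset.range M ×ˢ Finset.Icc 1 M),
        B.drawDeviation E q.1 M q.2.1 q.2.2
          (q.2.2 * (√(Real.log (1 / δ) / (2 * q.2.2)) - M * b)) := by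
    rintro z ⟨n, hn, hz⟩
    obtain ⟨i, a, ha, N, hN, h⟩ := B.exists_drawDeviation_of_detects hb hE hn hz
    exact Set.mem_biUnion (x := (i, a, N)) (by simpa [ha] using hN) h
  refine (measureReal_mono hsub (measure_ne_top _ _)).trans ((measureReal_biUnion_finset_le _ _).trans ?_)
  refine (Finset.sum_le_card_nsmul _ _ (2 * Real.exp (1 - Real.log (1 / δ))) fun q hq => ?_).trans ?_
  · simp only [Finset.mem_product] at hq
    exact B.measureReal_drawDeviation_le E q.1 hρ hM hq.2.2
  · rw [nsmul_eq_mul]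
    simp only [Finset.card_product, Finset.card_univ, Fintype.card_fin, Finset.card_range,
      Nat.card_Icc, Nat.add_sub_cancel]
    push_cast
    rw [pow_two]

end BaseBandit

end Windows

/-! ### Absence of detections bounds the drift. -/

namespace BaseBandit

variable {K L : ℕ} (B : BaseBandit K L) (E : Environment K)

/-- Arm `i` is selected at least once in any `D` consecutive rounds before `T`. -/
def Monitors (T D : ℕ) (z : ℕ → I × (Fin K → I)) (i : Fin K) : Prop :=
  ∀ t : ℕ, t + D ≤ T → ∃ s : ℕ, t ≤ s ∧ s < t + D ∧ i ∈ B.play z s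

variable {B E}

theorem Monitors.le_card_drawn {T D : ℕ} {z : ℕ → I × (Fin K → I)} {i : Fin K}
    (hi : B.Monitors T D z i) {y l n : ℕ} (hn : l + D * y ≤ n) (hT : n ≤ T) :
    y ≤ (B.drawn z i l n).card := by
  have hle := hn.trans hT
  rw [B.card_drawn_add z i (Nat.le_add_right l (D * y)) hn]
  refine le_add_right ?_
  clear hn
  induction y with
  | zero => simp
  | succ y ih =>
    rw [Nat.mul_succ] at hle ⊢
    rw [B.card_drawn_add z i (Nat.le_add_right l (D * y)) (by omega : l + D * y ≤ l + (D * y + D))]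
    obtain ⟨s, h1, h2, h3⟩ := hi (l + D * y) (by omega)
    refine add_le_add (ih (by omega)) (Finset.card_pos.2 ⟨s, ?_⟩)
    simp only [drawn, Finset.mem_filter, Finset.mem_Ico]
    exact ⟨⟨h1, by omega⟩, h3⟩

theorem abs_empMean_sub_le_of_not_detects {δ : ℝ} {z : ℕ → I × (Fin K → I)} {n : ℕ}
    (hρ : 0 ≤ Real.log (1 / δ)) (h : ¬ B.Detects δ z n) {i : Fin K} {m y : ℕ} (hy : 1 ≤ y)
    (hmn : m ≤ n) (h1 : y ≤ (B.drawn z i 0 m).card) (h2 : y ≤ (B.drawn z i m n).card) :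
    |B.empMean z i 0 m - B.empMean z i m n| ≤ 2 * √(Real.log (1 / δ) / (2 * y)) := by
  have hy' : (0 : ℝ) < y := by exact_mod_cast hy
  have hw : ∀ c : ℕ, y ≤ c → √(Real.log (1 / δ) / (2 * (c : ℝ))) ≤
      √(Real.log (1 / δ) / (2 * y)) := fun c hc => by
    have : (y : ℝ) ≤ c := by exact_mod_cast hc
    gcongr
  by_contra! hlt
  exact h ⟨i, m, hmn, hy.trans h1, hy.trans h2, by linarith [hw _ h1, hw _ h2]⟩

/-- The mean over [0, n) is a convex combination of the means over [0, m) and [m, n). -/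
theorem abs_empMean_sub_le_abs (z : ℕ → I × (Fin K → I)) (i : Fin K) {m n : ℕ} (hmn : m ≤ n)
    (h1 : 1 ≤ (B.drawn z i 0 m).card) (h2 : 1 ≤ (B.drawn z i m n).card) :
    |B.empMean z i 0 m - B.empMean z i 0 n| ≤ |B.empMean z i 0 m - B.empMean z i m n| := by
  have p1 : (0 : ℝ) < (B.drawn z i 0 m).card := by exact_mod_cast h1
  have p2 : (0 : ℝ) < (B.drawn z i m n).card := by exact_mod_cast h2
  have hc : ((B.drawn z i 0 n).card : ℝ) = (B.drawn z i 0 m).card + (B.drawn z i m n).card := by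
    exact_mod_cast B.card_drawn_add z i (Nat.zero_le m) hmn
  have hs : ∑ s ∈ B.drawn z i 0 n, ((z s).2 i : ℝ) =
      ∑ s ∈ B.drawn z i 0 m, ((z s).2 i : ℝ) + ∑ s ∈ B.drawn z i m n, ((z s).2 i : ℝ) := by
    rw [B.drawn_union z i (Nat.zero_le m) hmn, Finset.sum_union (B.drawn_disjoint z i 0 m n)]
  have heq : B.empMean z i 0 m - B.empMean z i 0 n =
      (B.empMean z i 0 m - B.empMean z i m n) *
        ((B.drawn z i m n).card / ((B.drawn z i 0 m).card + (B.drawn z i m n).card)) := by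
    simp only [empMean]
    rw [hs, hc]
    field_simp
    ring
  rw [heq, abs_mul]
  refine mul_le_of_le_one_right (abs_nonneg _) ?_
  rw [abs_of_nonneg (by positivity), div_le_one (by positivity)]
  linarith

/-- As long as no change is detected, the mean of a monitored arm has not drifted much. -/
theorem Monitors.abs_mean_sub_le {T T' D : ℕ} {z : ℕ → I × (Fin K → I)} {i : Fin K}
    (hi : B.Monitors T D z i) (hT : T' ≤ T) {b δ a : ℝ} (hb : 0 ≤ b) (ha : 0 ≤ a)
    (hE : E.Gradual T' b)
    (hρ : 0 ≤ Real.log (1 / δ)) {y l : ℕ} (hy : 1 ≤ y) (hl : l ≤ T')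
    (hdet : ∀ n < l, ¬ B.Detects δ z n)
    (hnoise : ∀ n ≤ T, |B.windowNoise E z i (n - D * y) n| ≤ a) {n : ℕ} (hn : n < l) :
    |E.mean i n - E.mean i 0| ≤
      4 * √(Real.log (1 / δ) / (2 * y)) + 2 * (a / y) + 3 * (D * y) * b := by
  have hy' : (0 : ℝ) < y := by exact_mod_cast hy
  rcases lt_or_ge n (3 * (D * y)) with hlt | hge
  · have h1 := hE.abs_mean_sub_le i (Nat.zero_le n) (by omega)
    have h2 : (n : ℝ) ≤ 3 * (D * y) := by exact_mod_cast hlt.le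
    have h3 : (n : ℝ) * b ≤ 3 * (D * y) * b := by gcongr
    have h4 : 0 ≤ 4 * √(Real.log (1 / δ) / (2 * y)) + 2 * (a / y) := by positivity
    simp only [Nat.cast_zero, sub_zero] at h1
    linarith
  -- The blocks [0, h) and [n − h, n) do not form a split, so they are compared through [0, n − h):
  -- the test at time n − h with split h ties its mean to the first block, the test at time n with
  -- split n − h to the last one. Three disjoint blocks of h rounds are needed, hence the case
  -- distinction at 3h.
  · set h := D * y with hh
    have c1 : y ≤ (B.drawn z i 0 h).card := hi.le_card_drawn (by omega) (by omega)
    have c2 : y ≤ (B.drawn z i h (n - h)).card := hi.le_card_drawn (by omega) (by omega)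
    have c3 : y ≤ (B.drawn z i (n - h) n).card := hi.le_card_drawn (by omega) (by omega)
    have c4 : y ≤ (B.drawn z i 0 (n - h)).card := hi.le_card_drawn (by omega) (by omega)
    have d1 := abs_empMean_sub_le_of_not_detects hρ (hdet (n - h) (by omega)) hy
      (by omega : h ≤ n - h) c1 c2
    have d2 := abs_empMean_sub_le_of_not_detects hρ (hdet n hn) hy (by omega : n - h ≤ n) c4 c3
    have d3 := (abs_empMean_sub_le_abs z i (by omega : h ≤ n - h) (hy.trans c1)
      (hy.trans c2)).trans d1
    have hdiv : ∀ {m r : ℕ}, y ≤ (B.drawn z i m r).card → |B.windowNoise E z i m r| ≤ a →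
        |B.windowNoise E z i m r| / (B.drawn z i m r).card ≤ a / y := fun hc hle => by
      have : (y : ℝ) ≤ _ := Nat.cast_le.2 hc
      gcongr
    have n1 := hdiv c1 (by simpa using hnoise h (by omega))
    have n2 := hdiv c3 (hnoise n (by omega))
    have e1 := B.abs_empMean_sub_le E (hy.trans c1) (v := E.mean i 0) (Δ := h * b)
      fun s _ hs => by
        refine (hE.abs_mean_sub_le i (Nat.zero_le s) (by omega)).trans ?_
        have : (s : ℝ) ≤ h := by exact_mod_cast hs.le
        simp only [Nat.cast_zero, sub_zero]
        gcongr
    have e2 := B.abs_empMean_sub_le E (hy.trans c3) (v := E.mean i n) (Δ := h * b)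
      fun s hs hs' => by
        rw [abs_sub_comm]
        refine (hE.abs_mean_sub_le i hs'.le (by omega)).trans ?_
        have : (n : ℝ) ≤ s + h := by exact_mod_cast (by omega : n ≤ s + h)
        gcongr
        linarith
    have hcast : (h : ℝ) = D * y := by rw [hh]; push_cast; ring
    rw [hcast] at e1 e2
    have hnn : 0 ≤ (D * y : ℝ) * b := by positivity
    rw [abs_le] at *
    constructor <;> linarith

/-- One arm whose mean stays near its initial value controls all arms; the factor 2 comes from
passing through round 0. -/
theorem drift_le_of_globalChanges {T' t : ℕ} {c X : ℝ} (hc : 0 < c) (hE : E.GlobalChanges T' c)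
    (i : Fin K) (hX : ∀ n ≤ t, |E.mean i n - E.mean i 0| ≤ X) (ht : t < T') :
    E.drift t ≤ 2 * (X / c) := by
  have hX0 : 0 ≤ X := (abs_nonneg _).trans (hX 0 (Nat.zero_le t))
  have key : ∀ j, ∀ s ≤ t, |E.mean j s - E.mean j 0| ≤ X / c := fun j s hs => by
    rw [le_div_iff₀ hc, mul_comm]
    exact (hE i j 0 s (by omega) (by omega)).trans (hX s hs)
  refine Real.iSup_le (fun q => ?_) (by positivity)
  have h1 := key q.1 q.2.1 (Nat.lt_succ_iff.1 q.2.1.isLt)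
  have h2 := key q.1 q.2.2 (Nat.lt_succ_iff.1 q.2.2.isLt)
  rw [abs_le] at *
  constructor <;> linarith

end BaseBandit

/-! ### Pathwise decomposition of the horizon into the windows of ADR-bandit. -/

theorem Finset.eq_Ico_of_convex {S : Finset ℕ} {τ : ℕ} (h1 : ∀ t ∈ S, τ ≤ t)
    (h2 : ∀ t ∈ S, ∀ s, τ ≤ s → s ≤ t → s ∈ S) : S = Finset.Ico τ (τ + S.card) := by
  rcases S.eq_empty_or_nonempty with rfl | hne
  · simp
  · have hmax := S.max'_mem hne
    have heq : S = Finset.Ico τ (S.max' hne + 1) := by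
      ext s
      rw [Finset.mem_Ico]
      exact ⟨fun hs => ⟨h1 s hs, Nat.lt_succ_of_le (S.le_max' s hs)⟩,
        fun hs => h2 _ hmax s hs.1 (Nat.le_of_lt_succ hs.2)⟩
    have hcard : S.card = S.max' hne + 1 - τ := by
      conv_lhs => rw [heq]
      exact Nat.card_Ico _ _
    have := h1 _ hmax
    rw [hcard, Nat.add_sub_cancel' (by omega)]
    exact heq

namespace Environment

variable {K : ℕ} (E : Environment K)

theorem mean_nonneg (i : Fin K) (t : ℕ) : 0 ≤ E.mean i t :=
  integral_nonneg fun x => (x i).2.1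

theorem mean_le_one (i : Fin K) (t : ℕ) : E.mean i t ≤ 1 := by
  have := integral_mono_of_nonneg (μ := E.law t) (f := fun x => (x i : ℝ)) (g := fun _ => (1 : ℝ))
    (Filter.Eventually.of_forall fun x => (x i).2.1) (integrable_const _)
    (Filter.Eventually.of_forall fun x => (x i).2.2)
  simpa [mean] using this

theorem topL_le (L t : ℕ) : E.topL L t ≤ L := by
  refine Real.iSup_le (fun J => ?_) (by positivity)
  refine (Finset.sum_le_card_nsmul _ _ 1 fun i _ => E.mean_le_one i t).trans_eq ?_
  simp [J.2]

theorem topL_nonneg (L t : ℕ) : 0 ≤ E.topL L t :=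
  Real.iSup_nonneg fun _ => Finset.sum_nonneg fun i _ => E.mean_nonneg i t

theorem regret_le (L : ℕ) (sel : ℕ → Finset (Fin K)) (S : ℕ) : E.regret L sel S ≤ S * L := by
  refine (Finset.sum_le_card_nsmul _ _ (L : ℝ) fun t _ => ?_).trans_eq (by simp)
  have := Finset.sum_nonneg fun i (_ : i ∈ sel t) => E.mean_nonneg i t
  linarith [E.topL_le L t]

end Environment

namespace BaseBandit

variable {K L : ℕ} (B : BaseBandit K L)

theorem not_detects_zero (δ : ℝ) (z : ℕ → I × (Fin K → I)) : ¬ B.Detects δ z 0 := by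
  rintro ⟨i, m, hm, h1, -⟩
  obtain rfl : m = 0 := by omega
  simp [drawn] at h1

/-- The rounds before `T` in the window of ADR-bandit that starts with round `τ`. -/
noncomputable def segment (δ : ℝ) (z : ℕ → I × (Fin K → I)) (T τ : ℕ) : Finset ℕ :=
  (Finset.range T).filter fun t => B.adrStart δ z t = τ

/-- The rounds before `T` with which a window of ADR-bandit starts. -/
noncomputable def restarts (δ : ℝ) (z : ℕ → I × (Fin K → I)) (T : ℕ) : Finset ℕ :=
  (Finset.range T).filter fun τ => B.adrStart δ z τ = τ

variable {B} {δ : ℝ} {z : ℕ → I × (Fin K → I)} {T τ : ℕ}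

theorem adrStart_of_succ {t : ℕ} (h : B.adrStart δ z (t + 1) = τ) (hτ : τ ≤ t) :
    B.adrStart δ z t = τ ∧ ¬ B.Detects δ (shiftSeq τ z) (t + 1 - τ) := by
  rw [adrStart] at h
  split_ifs at h with hd
  · omega
  · subst h; exact ⟨rfl, hd⟩

theorem adrStart_eq_of_le {t : ℕ} (h : B.adrStart δ z t = τ) {s : ℕ} (hs : τ ≤ s) (hst : s ≤ t) :
    B.adrStart δ z s = τ := by
  induction t, hst using Nat.le_induction with
  | base => exact h
  | succ t hst ih => exact ih (adrStart_of_succ h (by omega)).1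

theorem not_detects_of_adrStart {t : ℕ} (h : B.adrStart δ z t = τ) {n : ℕ} (hn : τ + n ≤ t) :
    ¬ B.Detects δ (shiftSeq τ z) n := by
  rcases n with _ | n
  · exact B.not_detects_zero δ _
  · have h1 := adrStart_eq_of_le h (s := τ + n + 1) (by omega) (by omega)
    have h2 := (adrStart_of_succ h1 (by omega)).2
    rwa [show τ + n + 1 - τ = n + 1 by omega] at h2

theorem adrStart_mem_restarts {t : ℕ} (ht : t < T) : B.adrStart δ z t ∈ B.restarts δ z T :=
  Finset.mem_filter.2 ⟨Finset.mem_range.2 ((B.adrStart_le δ z t).trans_lt ht),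
    adrStart_eq_of_le rfl le_rfl (B.adrStart_le δ z t)⟩

theorem segment_eq_Ico :
    B.segment δ z T τ = Finset.Ico τ (τ + (B.segment δ z T τ).card) := by
  refine Finset.eq_Ico_of_convex (fun t ht => ?_) fun t ht s hs hst => ?_
  · rw [← (Finset.mem_filter.1 ht).2]
    exact B.adrStart_le δ z t
  · obtain ⟨h1, h2⟩ := Finset.mem_filter.1 ht
    exact Finset.mem_filter.2 ⟨Finset.mem_range.2 (hst.trans_lt (Finset.mem_range.1 h1)),
      adrStart_eq_of_le h2 hs hst⟩

theorem segment_card_pos (h : τ ∈ B.restarts δ z T) : 0 < (B.segment δ z T τ).card := by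
  obtain ⟨h1, h2⟩ := Finset.mem_filter.1 h
  exact Finset.card_pos.2 ⟨τ, Finset.mem_filter.2 ⟨h1, h2⟩⟩

theorem last_mem_segment (h : τ ∈ B.restarts δ z T) :
    τ + (B.segment δ z T τ).card - 1 < T ∧
      B.adrStart δ z (τ + (B.segment δ z T τ).card - 1) = τ := by
  have hpos := segment_card_pos h
  have : τ + (B.segment δ z T τ).card - 1 ∈ B.segment δ z T τ := by
    have hm : τ + (B.segment δ z T τ).card - 1 ∈
        Finset.Ico τ (τ + (B.segment δ z T τ).card) := Finset.mem_Ico.2 (by omega)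
    rwa [← segment_eq_Ico] at hm
  exact ⟨Finset.mem_range.1 (Finset.mem_filter.1 this).1, (Finset.mem_filter.1 this).2⟩

theorem segment_card_le (h : τ ∈ B.restarts δ z T) : (B.segment δ z T τ).card ≤ T - τ := by
  have := (last_mem_segment h).1
  have := segment_card_pos h
  omega

/-- Only a detection can end a window before the horizon. -/
theorem detects_of_segment_lt (h : τ ∈ B.restarts δ z T)
    (hlt : τ + (B.segment δ z T τ).card < T) :
    B.Detects δ (shiftSeq τ z) (B.segment δ z T τ).card := by
  have hpos := segment_card_pos h
  obtain ⟨-, h1⟩ := last_mem_segment h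
  have hn : B.adrStart δ z (τ + (B.segment δ z T τ).card - 1 + 1) ≠ τ := by
    intro heq
    have : τ + (B.segment δ z T τ).card - 1 + 1 ∈ B.segment δ z T τ :=
      Finset.mem_filter.2 ⟨Finset.mem_range.2 (by omega), heq⟩
    have := (Finset.mem_Ico.1 (segment_eq_Ico.subset this)).2
    omega
  rw [adrStart, h1] at hn
  split_ifs at hn with hd
  · rwa [show τ + (B.segment δ z T τ).card - 1 + 1 - τ = (B.segment δ z T τ).card by omega] at hd
  · exact absurd rfl hn

theorem sum_segment_card : ∑ τ ∈ B.restarts δ z T, (B.segment δ z T τ).card = T := by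
  have := Finset.card_eq_sum_card_fiberwise (s := Finset.range T) (t := B.restarts δ z T)
    (f := B.adrStart δ z) fun t ht => adrStart_mem_restarts (Finset.mem_range.1 ht)
  rw [Finset.card_range] at this
  exact this.symm

theorem regret_adrPlay (E : Environment K) :
    E.regret L (B.adrPlay δ z) T = ∑ τ ∈ B.restarts δ z T,
      (E.shift τ).regret L (B.play (shiftSeq τ z)) (B.segment δ z T τ).card := by
  rw [Environment.regret, ← Finset.sum_fiberwise_of_maps_to (g := B.adrStart δ z)
    (t := B.restarts δ z T) fun t ht => adrStart_mem_restarts (Finset.mem_range.1 ht)]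
  refine Finset.sum_congr rfl fun τ _ => ?_
  change ∑ t ∈ B.segment δ z T τ, _ = _
  rw [Environment.regret]
  have hsum : ∀ f : ℕ → ℝ, ∑ t ∈ B.segment δ z T τ, f t =
      ∑ n ∈ Finset.range (B.segment δ z T τ).card, f (τ + n) := fun f => by
    conv_lhs => rw [segment_eq_Ico, Finset.sum_Ico_eq_sum_range, Nat.add_sub_cancel_left]
  rw [hsum]
  refine Finset.sum_congr rfl fun n hn => ?_
  have hst : B.adrStart δ z (τ + n) = τ := by
    have : τ + n ∈ B.segment δ z T τ := by
      rw [segment_eq_Ico, Finset.mem_Ico]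
      have := Finset.mem_range.1 hn
      omega
    exact (Finset.mem_filter.1 this).2
  simp only [adrPlay, hst, Nat.add_sub_cancel_left]
  rfl

open Classical in
/-- Most windows are either long or end with a detection soon after a restart. -/
theorem card_restarts_le (n₀ : ℕ) (G : ℕ → Set (ℕ → I × (Fin K → I)))
    (hG : ∀ τ z', ∀ n ≤ min n₀ (T - τ), B.Detects δ z' n → z' ∈ G τ) :
    ((B.restarts δ z T).card : ℝ) ≤ 1 + T / (n₀ + 1) +
      ((B.restarts δ z T).filter fun τ => shiftSeq τ z ∈ G τ).card := by
  set R := B.restarts δ z T with hR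
  set R₁ := R.filter fun τ => T ≤ τ + (B.segment δ z T τ).card with hR₁
  set R₂ := R.filter fun τ => n₀ + 1 ≤ (B.segment δ z T τ).card with hR₂
  set R₃ := R.filter fun τ => shiftSeq τ z ∈ G τ with hR₃
  have hsub : R ⊆ R₁ ∪ R₂ ∪ R₃ := fun τ hτ => by
    simp only [hR₁, hR₂, hR₃, Finset.mem_union, Finset.mem_filter, hτ, true_and]
    by_cases h1 : T ≤ τ + (B.segment δ z T τ).card
    · exact Or.inl (Or.inl h1)
    by_cases h2 : n₀ + 1 ≤ (B.segment δ z T τ).card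
    · exact Or.inl (Or.inr h2)
    · exact Or.inr (hG _ _ _ (le_min (by omega) (by omega)) (detects_of_segment_lt hτ (by omega)))
  have h1 : R₁.card ≤ 1 := by
    -- A window that reaches the horizon contains round T − 1, so there is at most one.
    have key : ∀ τ ∈ R₁, B.adrStart δ z (T - 1) = τ := fun τ hτ => by
      obtain ⟨hm, hle⟩ := Finset.mem_filter.1 hτ
      obtain ⟨ha, hb⟩ := last_mem_segment hm
      have := segment_card_pos hm
      rwa [show τ + (B.segment δ z T τ).card - 1 = T - 1 by omega] at hb
    exact Finset.card_le_one.2 fun τ hτ τ' hτ' => (key τ hτ).symm.trans (key τ' hτ')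
  have h2 : (R₂.card : ℝ) ≤ T / (n₀ + 1) := by
    rw [le_div_iff₀ (by positivity)]
    have : R₂.card * (n₀ + 1) ≤ T := by
      calc R₂.card * (n₀ + 1) ≤ ∑ τ ∈ R₂, (B.segment δ z T τ).card := by
            rw [← smul_eq_mul]
            exact Finset.card_nsmul_le_sum _ _ _ fun τ hτ => (Finset.mem_filter.1 hτ).2
        _ ≤ ∑ τ ∈ R, (B.segment δ z T τ).card :=
            Finset.sum_le_sum_of_subset (Finset.filter_subset _ _)
        _ = T := sum_segment_card
    exact_mod_cast this
  have h3 : (R.card : ℝ) ≤ R₁.card + R₂.card + R₃.card := by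
    exact_mod_cast (Finset.card_le_card hsub).trans ((Finset.card_union_le _ _).trans
      (Nat.add_le_add_right (Finset.card_union_le _ _) _))
  have h1' : (R₁.card : ℝ) ≤ 1 := by exact_mod_cast h1
  linarith

-- On good windows, √l ≤ (l/x + x)/2 makes the bound linear in the number of windows, so
-- expectations can be taken without knowing their lengths. Bad windows are charged the trivial T·L.
open Classical in
theorem regret_adrPlay_le (E : Environment K) {c ε x : ℝ} (hc : 0 ≤ c) (hx : 0 < x)
    (G : ℕ → Set (ℕ → I × (Fin K → I)))
    (hG : ∀ τ ∈ B.restarts δ z T, shiftSeq τ z ∉ G τ →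
      (E.shift τ).regret L (B.play (shiftSeq τ z)) (B.segment δ z T τ).card ≤
        c * (√((L : ℝ) * K * (B.segment δ z T τ).card) + L * ((B.segment δ z T τ).card * ε)))
    (hε : 0 ≤ ε) :
    E.regret L (B.adrPlay δ z) T ≤
      c * (√((L : ℝ) * K) * ((T / x + x * (B.restarts δ z T).card) / 2) + L * (T * ε)) +
        T * L * ((B.restarts δ z T).filter fun τ => shiftSeq τ z ∈ G τ).card := by
  rw [regret_adrPlay]
  set R := B.restarts δ z T
  have hsum : ∑ τ ∈ R, ((B.segment δ z T τ).card : ℝ) = T := by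
    exact_mod_cast sum_segment_card (B := B)
  have hterm : ∀ τ ∈ R,
      (E.shift τ).regret L (B.play (shiftSeq τ z)) (B.segment δ z T τ).card ≤
        c * (√((L : ℝ) * K) * (((B.segment δ z T τ).card / x + x) / 2) +
          L * ((B.segment δ z T τ).card * ε)) + if shiftSeq τ z ∈ G τ then (T * L : ℝ) else 0 := by
    intro τ hτ
    set l := (B.segment δ z T τ).card with hl
    have hnn : 0 ≤ c * (√((L : ℝ) * K) * ((l / x + x) / 2) + L * (l * ε)) := by positivity
    split_ifs with h
    · have h1 := (E.shift τ).regret_le L (B.play (shiftSeq τ z)) l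
      have hlT : (l : ℝ) ≤ T := by
        exact_mod_cast (segment_card_le hτ).trans (Nat.sub_le _ _)
      have : (l : ℝ) * L ≤ T * L := by gcongr
      linarith
    · rw [add_zero]
      refine (hG τ hτ h).trans ?_
      rw [Real.sqrt_mul (by positivity)]
      gcongr
      rw [le_div_iff₀ zero_lt_two, div_add' _ _ _ hx.ne', le_div_iff₀ hx]
      have hs := Real.sq_sqrt (Nat.cast_nonneg (α := ℝ) l)
      nlinarith [sq_nonneg (√(l : ℝ) - x)]
  refine (Finset.sum_le_sum hterm).trans_eq ?_
  rw [Finset.sum_add_distrib, ← Finset.mul_sum, Finset.sum_add_distrib, ← Finset.mul_sum,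
    ← Finset.mul_sum, ← Finset.sum_div, Finset.sum_add_distrib, ← Finset.sum_div,
    ← Finset.sum_mul, hsum, ← Finset.sum_filter]
  simp only [Finset.sum_const, nsmul_eq_mul]
  ring

end BaseBandit

/-! ### Integrability and the expected number of restarts. -/

namespace Environment

variable {K : ℕ} (E : Environment K)

theorem measurable_regret (L : ℕ) {sel : (ℕ → I × (Fin K → I)) → ℕ → Finset (Fin K)}
    (h : ∀ t i, MeasurableSet {z | i ∈ sel z t}) (S : ℕ) :
    Measurable fun z => E.regret L (sel z) S := by
  refine Finset.measurable_sum _ fun t _ => measurable_const.sub ?_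
  have : ∀ z, ∑ i ∈ sel z t, E.mean i t = ∑ i, if i ∈ sel z t then E.mean i t else 0 := fun z => by
    rw [Finset.sum_ite_mem, Finset.univ_inter]
  simp_rw [this]
  exact Finset.measurable_sum _ fun i _ => Measurable.ite (h t i) measurable_const measurable_const

theorem abs_regret_le (L : ℕ) {sel : ℕ → Finset (Fin K)} (h : ∀ t, (sel t).card = L) (S : ℕ) :
    |E.regret L sel S| ≤ S * L := by
  refine (Finset.abs_sum_le_sum_abs _ _).trans
    ((Finset.sum_le_card_nsmul _ _ (L : ℝ) fun t _ => ?_).trans_eq (by simp))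
  have h1 := Finset.sum_nonneg fun i (_ : i ∈ sel t) => E.mean_nonneg i t
  have h2 := Finset.sum_le_card_nsmul (sel t) (fun i => E.mean i t) 1 fun i _ => E.mean_le_one i t
  rw [h, nsmul_one] at h2
  have h3 := E.topL_le L t
  have h4 := E.topL_nonneg L t
  rw [abs_le]
  constructor <;> linarith

end Environment

namespace BaseBandit

variable {K L : ℕ} (B : BaseBandit K L) (E : Environment K)

theorem integrable_regret_adrPlay (δ : ℝ) (T : ℕ) :
    Integrable (fun z => E.regret L (B.adrPlay δ z) T) E.sampleMeasure := by
  have hm : Measurable fun z => E.regret L (B.adrPlay δ z) T :=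
    E.measurable_regret L (fun t i => B.measurableSet_adrPlay δ t fun J => i ∈ J) T
  refine Integrable.of_bound hm.aestronglyMeasurable (T * L)
    (Filter.Eventually.of_forall fun z => ?_)
  exact E.abs_regret_le L (fun t => B.card_play _ _) T

/-- The expected number of windows of ADR-bandit that start before round `T`. -/
noncomputable def expRestarts (δ : ℝ) (T : ℕ) : ℝ :=
  ∑ τ ∈ Finset.range T, E.sampleMeasure.real {z | B.adrStart δ z τ = τ}

theorem expRestarts_nonneg (δ : ℝ) (T : ℕ) : 0 ≤ B.expRestarts E δ T :=
  Finset.sum_nonneg fun _ _ => measureReal_nonneg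

theorem measurableSet_adrStart_eq (δ : ℝ) (τ : ℕ) :
    MeasurableSet {z : ℕ → I × (Fin K → I) | B.adrStart δ z τ = τ} :=
  B.measurable_adrStart δ τ (measurableSet_singleton τ)

variable {E} in
open Classical in
theorem card_filter_restarts_eq (δ : ℝ) (T : ℕ) (G : ℕ → Set (ℕ → I × (Fin K → I)))
    (z : ℕ → I × (Fin K → I)) :
    (((B.restarts δ z T).filter fun τ => shiftSeq τ z ∈ G τ).card : ℝ) =
      ∑ τ ∈ Finset.range T,
        ({z | B.adrStart δ z τ = τ} ∩ shiftSeq τ ⁻¹' G τ).indicator (fun _ => (1 : ℝ)) z := by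
  rw [restarts, Finset.filter_filter, Finset.card_filter, Nat.cast_sum]
  exact Finset.sum_congr rfl fun τ _ => by simp [Set.indicator]

open Classical in
theorem integrable_card_filter_restarts (δ : ℝ) (T : ℕ) {G : ℕ → Set (ℕ → I × (Fin K → I))}
    (hG : ∀ τ, MeasurableSet (G τ)) :
    Integrable (fun z => (((B.restarts δ z T).filter fun τ => shiftSeq τ z ∈ G τ).card : ℝ))
      E.sampleMeasure := by
  simp_rw [B.card_filter_restarts_eq]
  exact integrable_finsetSum _ fun τ _ => (integrable_const _).indicator
    ((B.measurableSet_adrStart_eq δ τ).inter (measurable_shiftSeq τ (hG τ)))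

open Classical in
/-- A restart is independent of the rounds that follow it. -/
theorem integral_card_filter_restarts_le (δ : ℝ) (T : ℕ) {G : ℕ → Set (ℕ → I × (Fin K → I))}
    (hG : ∀ τ, MeasurableSet (G τ)) {p : ℝ}
    (hp : ∀ τ < T, (E.shift τ).sampleMeasure.real (G τ) ≤ p) :
    ∫ z, (((B.restarts δ z T).filter fun τ => shiftSeq τ z ∈ G τ).card : ℝ) ∂E.sampleMeasure ≤
      p * B.expRestarts E δ T := by
  have hm := fun τ => (B.measurableSet_adrStart_eq δ τ).inter (measurable_shiftSeq τ (hG τ))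
  simp_rw [B.card_filter_restarts_eq]
  rw [integral_finsetSum _ fun τ _ => (integrable_const _).indicator (hm τ), expRestarts,
    Finset.mul_sum]
  refine Finset.sum_le_sum fun τ hτ => ?_
  rw [integral_indicator_const _ (hm τ), smul_eq_mul, mul_one,
    E.measureReal_inter_shiftSeq τ (B.measurableSet_adrStart_eq δ τ) _ (hG τ), mul_comm]
  · exact mul_le_mul_of_nonneg_right (hp τ (Finset.mem_range.1 hτ)) measureReal_nonneg
  · intro z z' h hz
    rwa [Set.mem_ofPred_eq, ← B.adrStart_congr h]

theorem integrable_card_restarts (δ : ℝ) (T : ℕ) :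
    Integrable (fun z => ((B.restarts δ z T).card : ℝ)) E.sampleMeasure := by
  classical
  simpa using B.integrable_card_filter_restarts E δ T (G := fun _ => Set.univ)
    fun _ => MeasurableSet.univ

theorem integral_card_restarts (δ : ℝ) (T : ℕ) :
    ∫ z, ((B.restarts δ z T).card : ℝ) ∂E.sampleMeasure = B.expRestarts E δ T := by
  classical
  have h := fun z => B.card_filter_restarts_eq δ T (fun _ => Set.univ) z
  simp only [Set.mem_univ, Finset.filter_true, Set.preimage_univ, Set.inter_univ] at h
  simp_rw [h]
  rw [integral_finsetSum _ fun τ _ =>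
    (integrable_const _).indicator (B.measurableSet_adrStart_eq δ τ), expRestarts]
  exact Finset.sum_congr rfl fun τ _ => by
    rw [integral_indicator_const _ (B.measurableSet_adrStart_eq δ τ), smul_eq_mul, mul_one]

variable {E}

/-- In a gradually changing environment, restarts are rare. -/
theorem expRestarts_le {T n₀ : ℕ} {b δ : ℝ} (hb : 0 ≤ b) (hE : E.Gradual T b)
    (hρ : 0 ≤ Real.log (1 / δ)) (hn₀ : 8 * Real.log (1 / δ) * n₀ ^ 3 * b ^ 2 ≤ 1)
    (hp : K * n₀ ^ 2 * (2 * Real.exp (1 - Real.log (1 / δ))) ≤ 1 / 2) :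
    B.expRestarts E δ T ≤ 2 * (1 + T / (n₀ + 1)) := by
  classical
  -- The cap T − τ keeps the event within the rounds in which the shifted environment is known to be
  -- gradual.
  obtain ⟨G, hGdef⟩ : ∃ G : ℕ → Set (ℕ → I × (Fin K → I)),
    G = fun τ => {z | ∃ n ≤ min n₀ (T - τ), B.Detects δ z n} := ⟨_, rfl⟩
  have hG : ∀ τ, MeasurableSet (G τ) := fun τ => by
    have : G τ = ⋃ n ∈ Set.Iic (min n₀ (T - τ)), {z | B.Detects δ z n} := by
      ext z; simp [hGdef]
    rw [this]
    exact MeasurableSet.biUnion (Set.to_countable _) fun n _ => B.measurableSet_detects δ n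
  have hprob : ∀ τ < T, (E.shift τ).sampleMeasure.real (G τ) ≤ 1 / 2 := fun τ _ => by
    have hle : ((min n₀ (T - τ) : ℕ) : ℝ) ≤ n₀ := by exact_mod_cast min_le_left _ _
    rw [hGdef]
    refine (B.measureReal_detects_le hb ((hE.shift τ).mono (min_le_right _ _)) hρ ?_).trans ?_
    · refine le_trans ?_ hn₀
      gcongr
    · refine le_trans ?_ hp
      gcongr
  have hGi := B.integrable_card_filter_restarts E δ T hG
  have hint : ∫ z, ((B.restarts δ z T).card : ℝ) ∂E.sampleMeasure ≤
      ∫ z, ((1 + (T : ℝ) / (n₀ + 1)) + (((B.restarts δ z T).filter fun τ =>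
        shiftSeq τ z ∈ G τ).card : ℝ)) ∂E.sampleMeasure :=
    integral_mono (B.integrable_card_restarts E δ T) ((integrable_const _).add hGi)
      fun z => card_restarts_le n₀ G fun τ z' n hn hd => by rw [hGdef]; exact ⟨n, hn, hd⟩
  rw [B.integral_card_restarts, integral_add (integrable_const _) hGi, integral_const,
    probReal_univ, one_smul] at hint
  -- The expected number of early detections is at most half the expected number of restarts and is
  -- absorbed on the left.
  have := B.integral_card_filter_restarts_le E δ T hG hprob
  linarith

/-! ### Bad events and the regret within one window. -/

variable (E) in
/-- The base bandit run alone violates its regret bound or its monitoring consistency, or the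
rewards in some window of `h` rounds deviate from their means. -/
def badEvent (T D : ℕ) (c : ℝ) (h : ℕ) (a : ℝ) : Set (ℕ → I × (Fin K → I)) :=
  {z | ∀ S : ℕ, 1 ≤ S → S ≤ T → E.regret L (B.play z) S ≤
    c * (√((L : ℝ) * K * S) + L * ∑ t ∈ Finset.range S, E.drift t)}ᶜ ∪
  {z | ∃ i, ∃ n ≤ T, a ≤ |B.windowNoise E z i (n - h) n|} ∪
  {z | ¬ ∃ i, B.Monitors T D z i}

/-- Union bound over all arms and all right endpoints. All arms are needed because the monitored arm
may depend on the sample. -/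
theorem measureReal_windowNoise_le (T h : ℕ) {l : ℝ} (hl : 0 ≤ l) (a : ℝ) :
    E.sampleMeasure.real {z | ∃ i, ∃ n ≤ T, a ≤ |B.windowNoise E z i (n - h) n|} ≤
      K * (T + 1) * (2 * Real.exp (-(l * a) + l ^ 2 / 8 * h)) := by
  have hsub : {z | ∃ i, ∃ n ≤ T, a ≤ |B.windowNoise E z i (n - h) n|} ⊆
      ⋃ q ∈ (Finset.univ : Finset (Fin K)) ×ˢ Finset.range (T + 1),
        {z | a ≤ |E.selNoise (B.drawFrom q.1 (q.2 - h)) q.1 q.2 z| ∧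
          selCount (B.drawFrom q.1 (q.2 - h)) q.2 z ≤ h} := by
    rintro z ⟨i, n, hn, hz⟩
    have hW := B.drawn_subset_range z i (m := n - h) (le_refl n)
    have hiff := fun s hs => B.mem_drawFrom_iff z i (n - h) n s hs
    refine Set.mem_biUnion (x := (i, n)) (by simpa [Nat.lt_succ_iff] using hn) ⟨?_, ?_⟩
    · rw [E.selNoise_eq_sum hW hiff]
      exact hz
    · rw [selCount_eq_card hW hiff]
      exact_mod_cast (B.card_drawn_le z i (n - h) n).trans (by omega)
  refine (measureReal_mono hsub (measure_ne_top _ _)).trans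
    ((measureReal_biUnion_finset_le _ _).trans ?_)
  refine (Finset.sum_le_card_nsmul _ _ _ fun q _ =>
    Environment.measureReal_abs_selNoise_ge_le (B.isPredictable_drawFrom _ _) _ _ hl a h).trans_eq ?_
  rw [nsmul_eq_mul]
  simp

theorem measureReal_badEvent_le {T D : ℕ} {c : ℝ} (hDT : B.StrongDT T c)
    (hM : B.MonitoringConsistent T D) (h : ℕ) {l : ℝ} (hl : 0 ≤ l) (a : ℝ) :
    E.sampleMeasure.real (B.badEvent E T D c h a) ≤
      4 * K / (T : ℝ) ^ 2 + K * (T + 1) * (2 * Real.exp (-(l * a) + l ^ 2 / 8 * h)) := by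
  have h1 : MeasurableSet {z | ∀ S : ℕ, 1 ≤ S → S ≤ T → E.regret L (B.play z) S ≤
      c * (√((L : ℝ) * K * S) + L * ∑ t ∈ Finset.range S, E.drift t)} := by
    simp only [Set.ofPred_forall]
    refine MeasurableSet.iInter fun S => MeasurableSet.iInter fun _ => MeasurableSet.iInter fun _ =>
      measurableSet_le ?_ measurable_const
    exact E.measurable_regret L (fun t i => B.measurableSet_play t fun J => i ∈ J) S
  have h2 : E.sampleMeasure.real {z | ¬ ∃ i, B.Monitors T D z i} = 0 := by
    rw [measureReal_def, ENNReal.toReal_eq_zero_iff]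
    exact Or.inl (ae_iff.1 (hM E))
  have h3 := hDT E
  have h4 := B.measureReal_windowNoise_le (E := E) T h hl a
  refine (measureReal_union_le _ _).trans ?_
  rw [h2, add_zero]
  refine (measureReal_union_le _ _).trans (add_le_add ?_ h4)
  rw [probReal_compl_eq_one_sub h1]
  linarith

/-- Up to its last round the window has passed every test, so off the bad event the drift bound for
the monitored arm applies and extends to all arms. -/
theorem regret_segment_le {T D y : ℕ} {c b δ a Cgr : ℝ} (hc : 0 ≤ c) (hb : 0 ≤ b) (ha : 0 ≤ a)
    (hρ : 0 ≤ Real.log (1 / δ)) (hy : 1 ≤ y) (hCgr : 0 < Cgr) (hE : E.Gradual T b)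
    (hE' : E.GlobalChanges T Cgr) {z : ℕ → I × (Fin K → I)} {τ : ℕ}
    (hτ : τ ∈ B.restarts δ z T)
    (hz : shiftSeq τ z ∉ B.badEvent (E.shift τ) T D c (D * y) a) :
    (E.shift τ).regret L (B.play (shiftSeq τ z)) (B.segment δ z T τ).card ≤
      c * (√((L : ℝ) * K * (B.segment δ z T τ).card) + L * ((B.segment δ z T τ).card *
        (2 * ((4 * √(Real.log (1 / δ) / (2 * y)) + 2 * (a / y) + 3 * (D * y) * b) / Cgr)))) := by
  simp only [badEvent, Set.mem_union, not_or, Set.mem_compl_iff, not_not, Set.mem_ofPred_eq] at hz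
  obtain ⟨⟨h1, h2⟩, i, hi⟩ := hz
  push Not at h2
  have hle := segment_card_le hτ
  refine (h1 _ (segment_card_pos hτ) (hle.trans (Nat.sub_le _ _))).trans ?_
  gcongr
  refine (Finset.sum_le_card_nsmul _ _ _ fun t ht => ?_).trans_eq
    (by rw [Finset.card_range, nsmul_eq_mul])
  have ht := Finset.mem_range.1 ht
  refine drift_le_of_globalChanges hCgr (hE'.shift τ) i (fun n hn => ?_) (ht.trans_le hle)
  refine hi.abs_mean_sub_le (Nat.sub_le T τ) hb ha (hE.shift τ) hρ hy hle (fun n hn => ?_)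
    (fun n hn => (h2 i n hn).le) (hn.trans_lt ht)
  exact not_detects_of_adrStart (last_mem_segment hτ).2 (by omega)

end BaseBandit

namespace BaseBandit

variable {K L : ℕ} {B : BaseBandit K L} {E : Environment K}

theorem StrongDT.mono {T : ℕ} {c c' : ℝ} (h : B.StrongDT T c) (hc : c ≤ c') :
    B.StrongDT T c' := fun E => by
  refine (h E).trans (measureReal_mono (fun z hz S h1 h2 => (hz S h1 h2).trans ?_)
    (measure_ne_top _ _))
  have : 0 ≤ ∑ t ∈ Finset.range S, E.drift t :=
    Finset.sum_nonneg fun t _ => Real.iSup_nonneg fun q => abs_nonneg _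
  gcongr

theorem MonitoringConsistent.pos {T D : ℕ} (h : B.MonitoringConsistent T D)
    (E : Environment K) : 0 < D := by
  rcases Nat.eq_zero_or_pos D with rfl | hD
  · obtain ⟨z, i, hz⟩ := (h E).exists
    obtain ⟨s, h1, h2, -⟩ := hz 0 (Nat.zero_le _)
    omega
  · exact hD

/-- The expected regret of ADR-bandit in terms of the expected number of restarts. -/
theorem integral_regret_adrPlay_le {T D y : ℕ} {c b δ a Cgr x l : ℝ} (hc : 0 ≤ c) (hb : 0 ≤ b)
    (ha : 0 ≤ a) (hx : 0 < x) (hl : 0 ≤ l) (hρ : 0 ≤ Real.log (1 / δ)) (hy : 1 ≤ y)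
    (hCgr : 0 < Cgr) (hDT : B.StrongDT T c) (hM : B.MonitoringConsistent T D)
    (hE : E.Gradual T b) (hE' : E.GlobalChanges T Cgr) :
    ∫ z, E.regret L (B.adrPlay δ z) T ∂E.sampleMeasure ≤
      c * (√((L : ℝ) * K) * ((T / x + x * B.expRestarts E δ T) / 2) + L * (T *
        (2 * ((4 * √(Real.log (1 / δ) / (2 * y)) + 2 * (a / y) + 3 * (D * y) * b) / Cgr)))) +
      T * L * ((4 * K / (T : ℝ) ^ 2 + K * (T + 1) *
        (2 * Real.exp (-(l * a) + l ^ 2 / 8 * (D * y : ℕ)))) * B.expRestarts E δ T) := by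
  classical
  set ε := 2 * ((4 * √(Real.log (1 / δ) / (2 * y)) + 2 * (a / y) + 3 * (D * y) * b) / Cgr)
  have hε : 0 ≤ ε := by positivity
  -- Measurable hulls have the same probability and spare a measurability proof for the bad event.
  obtain ⟨G, hGdef⟩ : ∃ G : ℕ → Set (ℕ → I × (Fin K → I)), G = fun τ =>
    toMeasurable (E.shift τ).sampleMeasure (B.badEvent (E.shift τ) T D c (D * y) a) := ⟨_, rfl⟩
  have hG : ∀ τ, MeasurableSet (G τ) := fun τ => by
    rw [hGdef]; exact measurableSet_toMeasurable _ _
  have hprob : ∀ τ < T, (E.shift τ).sampleMeasure.real (G τ) ≤ 4 * K / (T : ℝ) ^ 2 +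
      K * (T + 1) * (2 * Real.exp (-(l * a) + l ^ 2 / 8 * (D * y : ℕ))) := fun τ _ => by
    rw [hGdef, measureReal_def, measure_toMeasurable, ← measureReal_def]
    exact B.measureReal_badEvent_le (E := E.shift τ) hDT hM (D * y) hl a
  have hi1 := B.integrable_card_restarts E δ T
  have hi2 := B.integrable_card_filter_restarts E δ T hG
  have hle : ∀ z, E.regret L (B.adrPlay δ z) T ≤
      (c * √((L : ℝ) * K) * x / 2) * (B.restarts δ z T).card + (T * L *
        ((B.restarts δ z T).filter fun τ => shiftSeq τ z ∈ G τ).card +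
        c * (√((L : ℝ) * K) * (T / x / 2) + L * (T * ε))) := fun z => by
    refine (regret_adrPlay_le E hc hx G (fun τ hτ hz =>
      B.regret_segment_le hc hb ha hρ hy hCgr hE hE' hτ fun hbad => hz ?_) hε).trans_eq (by ring)
    rw [hGdef]
    exact subset_toMeasurable _ _ hbad
  have hi3 : Integrable (fun z => (T * L : ℝ) *
      ((B.restarts δ z T).filter fun τ => shiftSeq τ z ∈ G τ).card +
        c * (√((L : ℝ) * K) * (T / x / 2) + L * (T * ε))) E.sampleMeasure :=
    (hi2.const_mul _).add (integrable_const _)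
  have hi4 := hi1.const_mul (c * √((L : ℝ) * K) * x / 2)
  refine (integral_mono (B.integrable_regret_adrPlay E δ T) (hi4.add hi3) hle).trans ?_
  rw [integral_add' hi4 hi3,
    integral_add (hi2.const_mul _) (integrable_const _), integral_const_mul, integral_const_mul,
    integral_const, probReal_univ, one_smul, B.integral_card_restarts]
  have h2 := B.integral_card_filter_restarts_le E δ T hG hprob
  have h3 := mul_le_mul_of_nonneg_left h2 (by positivity : (0 : ℝ) ≤ T * L)
  refine (add_le_add_right (add_le_add_left h3 _) _).trans_eq ?_
  ring

end BaseBandit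

/-! ### Numerical estimates, with t = T, e = 1 + log T and x = T^(d/3). -/

/-- The two hypotheses of `expRestarts_le` for n₀ = n: 3e bounds log(1/δ), and 3/t³ bounds exp(1 −
log(1/δ)). -/
theorem detection_budget {k t e x n : ℝ} (ht : 0 < t) (he : 1 ≤ e) (hx : 1 ≤ x) (hxt : x ^ 2 ≤ t)
    (hk : k ≤ t) (hn0 : 0 ≤ n) (hn : n ≤ x ^ 2 / (10 * e)) :
    8 * (3 * e) * n ^ 3 * (1 / x ^ 3) ^ 2 ≤ 1 ∧ k * n ^ 2 * (2 * (3 / t ^ 3)) ≤ 1 / 2 := by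
  have he0 : 0 < e := by linarith
  have hn' : n * (10 * e) ≤ x ^ 2 := (le_div_iff₀ (by positivity)).1 hn
  have hnx : 10 * n ≤ x ^ 2 := by nlinarith
  constructor
  · have h3 : (n * (10 * e)) ^ 3 ≤ (x ^ 2) ^ 3 := by gcongr
    have h4 : 24 * e * n ^ 3 ≤ (n * (10 * e)) ^ 3 := by
      have : 24 * e ≤ 1000 * e ^ 3 := by nlinarith [mul_pos he0 he0, pow_pos he0 3]
      calc 24 * e * n ^ 3 ≤ 1000 * e ^ 3 * n ^ 3 := by gcongr
        _ = _ := by ring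
    rw [div_pow, one_pow, mul_one_div, div_le_one (by positivity)]
    calc 8 * (3 * e) * n ^ 3 = 24 * e * n ^ 3 := by ring
      _ ≤ (x ^ 2) ^ 3 := h4.trans h3
      _ = _ := by ring
  · have h1 : (10 * n) ^ 2 ≤ t ^ 2 := by
      have : 10 * n ≤ t := hnx.trans hxt
      gcongr
    have h2 : k * n ^ 2 ≤ t * (t ^ 2 / 100) := by
      gcongr
      linarith
    calc k * n ^ 2 * (2 * (3 / t ^ 3)) ≤ t * (t ^ 2 / 100) * (2 * (3 / t ^ 3)) := by gcongr
      _ = 6 / 100 := by field_simp; ring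
      _ ≤ 1 / 2 := by norm_num

/-- With y ≈ x² the detection radius, the noise and the drift within D·y rounds are each at most
2De/x. Their weights 4, 2, 3 give 18, doubled to 36. -/
theorem drift_budget {D y e x ρ g : ℝ} (hD : 1 ≤ D) (hx : 1 ≤ x) (he : 1 ≤ e)
    (hρ : ρ ≤ 3 * e) (hy : x ^ 2 ≤ y) (hy' : y ≤ 2 * x ^ 2) (hg : 0 < g) :
    2 * ((4 * √(ρ / (2 * y)) + 2 * (√(2 * (D * y) * e) / y) + 3 * (D * y) * (1 / x ^ 3)) / g) ≤
      36 * D * e / (g * x) := by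
  have hx0 : 0 < x := by linarith
  have hy0 : 0 < y := (by positivity : 0 < x ^ 2).trans_le hy
  have h1 : √(ρ / (2 * y)) ≤ 2 * e / x := by
    refine Real.sqrt_le_iff.2 ⟨by positivity, ?_⟩
    rw [div_pow, div_le_div_iff₀ (by positivity) (by positivity)]
    calc ρ * x ^ 2 ≤ (3 * e) * y := by gcongr
      _ ≤ (2 * e) ^ 2 * (2 * y) := by nlinarith [mul_pos (by linarith : 0 < e) hy0]
  have h2 : √(2 * (D * y) * e) / y ≤ 2 * D * e / x := by
    rw [div_le_iff₀ hy0]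
    refine Real.sqrt_le_iff.2 ⟨by positivity, ?_⟩
    rw [mul_pow, div_pow, div_mul_eq_mul_div, le_div_iff₀ (by positivity)]
    have hDe : 1 ≤ D * e := by nlinarith
    calc 2 * (D * y) * e * x ^ 2 ≤ 2 * (D * y) * e * y := by gcongr
      _ = 2 * (D * e) * 1 * y ^ 2 := by ring
      _ ≤ 4 * (D * e) * (D * e) * y ^ 2 := by gcongr; norm_num
      _ = _ := by ring
  have h3 : D * y * (1 / x ^ 3) ≤ 2 * D * e / x := by
    rw [mul_one_div, div_le_div_iff₀ (by positivity) hx0]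
    calc D * y * x ≤ D * (2 * x ^ 2) * x := by gcongr
      _ = 2 * D * 1 * x ^ 3 := by ring
      _ ≤ 2 * D * e * x ^ 3 := by gcongr
  have h4 : e / x ≤ D * e / x := by
    gcongr
    nlinarith
  calc 2 * ((4 * √(ρ / (2 * y)) + 2 * (√(2 * (D * y) * e) / y) + 3 * (D * y) * (1 / x ^ 3)) / g)
      ≤ 2 * ((18 * (D * e / x)) / g) := by
        gcongr
        have e1 : 2 * e / x = 2 * (e / x) := by ring
        have e2 : 2 * D * e / x = 2 * (D * e / x) := by ring
        rw [e1] at h1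
        rw [e2] at h2 h3
        linarith
    _ = 36 * D * e / (g * x) := by field_simp; ring

/-- Here s = √(LK), and L ≤ s ≤ T. The last summand is at most 8(LK/T)r ≤ 8sr, and 8·22 = 176. -/
theorem regret_budget {t x e c c₀ s l k r η D g : ℝ} {p : ℕ} (ht : 2 ≤ t) (hx : 1 ≤ x)
    (he : 1 ≤ e) (hc0 : 0 ≤ c) (hc : c ≤ c₀ * e ^ p) (hs : s ^ 2 = l * k)
    (hs0 : 0 ≤ s) (hst : s ≤ t) (hl0 : 0 ≤ l) (hls : l ≤ s) (hr0 : 0 ≤ r)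
    (hr : r ≤ 22 * e * t / x ^ 2) (hD : 1 ≤ D) (hg : 0 < g)
    (hη : η ≤ 36 * D * e / (g * x)) {P : ℝ} (hP : P ≤ 8 * k / t ^ 2) :
    c * (s * ((t / x + x * r) / 2) + l * (t * η)) + t * l * (P * r) ≤
      (c₀ * (12 + 36 * D / g) + 176) * e ^ (p + 1) * (s * (t / x)) := by
  have hx0 : 0 < x := by linarith
  have ht0 : 0 < t := by linarith
  have he0 : 0 < e := by linarith
  have hu : 0 ≤ t / x := by positivity
  have h1 : x * r ≤ 22 * e * (t / x) := by
    calc x * r ≤ x * (22 * e * t / x ^ 2) := by gcongr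
      _ = _ := by field_simp
  have h2 : (t / x + x * r) / 2 ≤ 12 * e * (t / x) := by
    have : t / x ≤ e * (t / x) := le_mul_of_one_le_left hu he
    linarith
  have h3 : t * η ≤ 36 * D / g * e * (t / x) := by
    calc t * η ≤ t * (36 * D * e / (g * x)) := by gcongr
      _ = _ := by field_simp
  have h4 : 0 ≤ 36 * D / g * e * (t / x) := by positivity
  have h5 : c * (s * ((t / x + x * r) / 2) + l * (t * η)) ≤
      c₀ * e ^ p * (s * (12 * e * (t / x)) + s * (36 * D / g * e * (t / x))) := by
    have : s * ((t / x + x * r) / 2) + l * (t * η) ≤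
        s * (12 * e * (t / x)) + s * (36 * D / g * e * (t / x)) := by
      refine add_le_add (by gcongr) ?_
      exact (mul_le_mul_of_nonneg_left h3 hl0).trans (mul_le_mul_of_nonneg_right hls h4)
    exact (mul_le_mul_of_nonneg_left this hc0).trans
      (mul_le_mul_of_nonneg_right hc (by positivity))
  have h6 : t * l * (P * r) ≤ 176 * e ^ (p + 1) * (s * (t / x)) := by
    calc t * l * (P * r) ≤ t * l * (8 * k / t ^ 2 * r) := by gcongr
      _ = 8 * (s * s) / t * r := by rw [← pow_two, hs]; field_simp
      _ ≤ 8 * (s * t) / t * r := by gcongr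
      _ = 8 * s * r := by field_simp
      _ ≤ 8 * s * (22 * e * t / x ^ 2) := by gcongr
      _ = 176 * e * (s * (t / x)) * (1 / x) := by field_simp; ring
      _ ≤ 176 * e * (s * (t / x)) * 1 := by
        gcongr
        rw [div_le_one hx0]
        exact hx
      _ = 176 * e ^ 1 * (s * (t / x)) := by ring
      _ ≤ 176 * e ^ (p + 1) * (s * (t / x)) := by
        gcongr
        omega
  calc _ ≤ c₀ * e ^ p * (s * (12 * e * (t / x)) + s * (36 * D / g * e * (t / x))) +
        176 * e ^ (p + 1) * (s * (t / x)) := add_le_add h5 h6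
    _ = _ := by rw [pow_succ]; ring

theorem expRestarts_budget {t x e r n : ℝ} (ht : 0 < t) (hx : 1 ≤ x) (he : 1 ≤ e)
    (hxt : x ^ 2 ≤ t) (hn : x ^ 2 / (10 * e) ≤ n) (hr : r ≤ 2 * (1 + t / n)) :
    r ≤ 22 * e * t / x ^ 2 := by
  have hx0 : 0 < x := by linarith
  have he0 : 0 < e := by linarith
  have h1 : t / n ≤ 10 * e * t / x ^ 2 := by
    calc t / n ≤ t / (x ^ 2 / (10 * e)) := by gcongr
      _ = _ := by field_simp
  have h2 : 1 ≤ e * t / x ^ 2 := by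
    rw [one_le_div (by positivity)]
    nlinarith
  calc r ≤ 2 * (e * t / x ^ 2 + 10 * e * t / x ^ 2) := by linarith
    _ = _ := by ring

/-- For a = √(2Dye) the choice l = 4a/(Dy) minimizes the Hoeffding exponent, with value −2a²/(Dy) =
−4e. The factor exp(−4e) ≤ t^(-4) pays for the union bound. -/
theorem deviation_budget {D y e t k : ℝ} (hD : 1 ≤ D) (hy : 1 ≤ y) (ht : 2 ≤ t)
    (he : e = 1 + Real.log t) (hk : 0 ≤ k) :
    4 * k / t ^ 2 + k * (t + 1) * (2 * Real.exp (-(4 * √(2 * (D * y) * e) / (D * y) *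
      √(2 * (D * y) * e)) + (4 * √(2 * (D * y) * e) / (D * y)) ^ 2 / 8 * (D * y))) ≤
      8 * k / t ^ 2 := by
  have ht0 : 0 < t := by linarith
  have hlog : 0 ≤ Real.log t := Real.log_nonneg (by linarith)
  have h0 : 0 < D * y := by nlinarith
  have he0 : 0 ≤ e := by linarith
  have hsq : √(2 * (D * y) * e) ^ 2 = 2 * (D * y) * e := Real.sq_sqrt (by positivity)
  have hexp : -(4 * √(2 * (D * y) * e) / (D * y) * √(2 * (D * y) * e)) +
      (4 * √(2 * (D * y) * e) / (D * y)) ^ 2 / 8 * (D * y) = -(4 * e) := by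
    have : -(4 * √(2 * (D * y) * e) / (D * y) * √(2 * (D * y) * e)) +
      (4 * √(2 * (D * y) * e) / (D * y)) ^ 2 / 8 * (D * y) =
        -(2 * √(2 * (D * y) * e) ^ 2 / (D * y)) := by field_simp; ring
    rw [this, hsq]
    field_simp
    ring
  have hle : Real.exp (-(4 * e)) ≤ 1 / t ^ 4 := by
    have h4 : t ^ 4 = Real.exp (4 * Real.log t) := by
      rw [← Real.exp_log ht0, ← Real.exp_nat_mul, Real.exp_log ht0]
      norm_num
    rw [h4, one_div, ← Real.exp_neg, Real.exp_le_exp, he]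
    linarith
  rw [hexp]
  calc 4 * k / t ^ 2 + k * (t + 1) * (2 * Real.exp (-(4 * e)))
      ≤ 4 * k / t ^ 2 + k * (t + t) * (2 * (1 / t ^ 4)) := by gcongr; linarith
    _ = 4 * k / t ^ 2 + 4 * k / t ^ 2 * (1 / t) := by field_simp; ring
    _ ≤ 4 * k / t ^ 2 + 4 * k / t ^ 2 * 1 := by
      gcongr
      rw [div_le_one ht0]
      linarith
    _ = _ := by ring

/-! ### Choice of the parameters and conclusion. -/

theorem mainTheorem2 (d : ℝ) (hd : 0 < d) (hd' : d < 3 / 2)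
    (Cgr : ℝ) (hCgr : 0 < Cgr) (hCgr' : Cgr ≤ 1) (D : ℕ) (A : ℝ) (p : ℕ) :
    ∃ (C : ℝ) (q : ℕ), ∀ (T K L : ℕ), 2 ≤ T → 1 ≤ L → L ≤ K → K ≤ T →
      ∀ (B : BaseBandit K L) (E : Environment K),
        B.StrongDT T (A * Real.log T ^ p) →
        B.MonitoringConsistent T D →
        E.Gradual T ((T : ℝ) ^ (-d)) →
        E.GlobalChanges T Cgr →
        Integrable (fun z => E.regret L (B.adrPlay (1 / (T : ℝ) ^ 3) z) T) E.sampleMeasure ∧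
        ∫ z, E.regret L (B.adrPlay (1 / (T : ℝ) ^ 3) z) T ∂E.sampleMeasure ≤
          C * Real.log T ^ q * (√((L : ℝ) * K) * (T : ℝ) ^ (1 - d / 3)) := by
  refine ⟨(|A| * (12 + 36 * D / Cgr) + 176) * 3 ^ (p + 1), p + 1,
    fun T K L hT hL hLK hKT B E hDT hM hE hE' => ⟨B.integrable_regret_adrPlay E _ T, ?_⟩⟩
  have hT' : (2 : ℝ) ≤ T := by exact_mod_cast hT
  have hLK' : (L : ℝ) ≤ K := by exact_mod_cast hLK
  have hKT' : (K : ℝ) ≤ T := by exact_mod_cast hKT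
  have hT0 : (0 : ℝ) < T := by linarith
  have hlog : 0 ≤ Real.log T := Real.log_nonneg (by linarith)
  have hlog2 : 1 ≤ 2 * Real.log T := by
    have := Real.log_le_log zero_lt_two hT'
    linarith [Real.log_two_gt_d9]
  obtain ⟨e, he⟩ : ∃ e, e = 1 + Real.log T := ⟨_, rfl⟩
  have he1 : 1 ≤ e := by linarith
  have he0 : 0 < e := by linarith
  obtain ⟨x, hx⟩ : ∃ x, x = (T : ℝ) ^ (d / 3) := ⟨_, rfl⟩
  have hx1 : 1 ≤ x := hx ▸ Real.one_le_rpow (by linarith) (by linarith)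
  have hx0 : 0 < x := by linarith
  -- Here d < 3/2 enters: the critical window length x² = T^(2d/3) fits into the horizon.
  have hx2 : x ^ 2 ≤ T := by
    rw [hx, ← Real.rpow_natCast, ← Real.rpow_mul hT0.le]
    refine (Real.rpow_le_rpow_of_exponent_le (by linarith) ?_).trans_eq (Real.rpow_one _)
    push_cast
    linarith
  have hb : (T : ℝ) ^ (-d) = 1 / x ^ 3 := by
    rw [hx, ← Real.rpow_natCast, ← Real.rpow_mul hT0.le, Real.rpow_neg hT0.le, one_div]
    congr 2
    push_cast
    ring
  have hTx : (T : ℝ) ^ (1 - d / 3) = T / x := by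
    rw [hx, Real.rpow_sub hT0, Real.rpow_one]
  have hρ : Real.log (1 / (1 / (T : ℝ) ^ 3)) = 3 * Real.log T := by
    rw [one_div_one_div, Real.log_pow]
    norm_num
  have hρ0 : 0 ≤ Real.log (1 / (1 / (T : ℝ) ^ 3)) := by rw [hρ]; positivity
  have hD : 1 ≤ D := hM.pos E
  have hD' : (1 : ℝ) ≤ D := by exact_mod_cast hD
  have hc : B.StrongDT T (|A| * Real.log T ^ p) :=
    hDT.mono (mul_le_mul_of_nonneg_right (le_abs_self A) (by positivity))
  rw [hb] at hE
  -- the number of restarts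
  obtain ⟨hb1, hb2⟩ := detection_budget (n := (⌊x ^ 2 / (10 * e)⌋₊ : ℕ)) hT0 he1 hx1 hx2 hKT'
    (Nat.cast_nonneg _) (Nat.floor_le (by positivity))
  have hr := B.expRestarts_le (δ := 1 / (T : ℝ) ^ 3) (n₀ := ⌊x ^ 2 / (10 * e)⌋₊) (by positivity) hE
    hρ0 (le_trans (by rw [hρ]; gcongr; linarith) hb1) (le_trans (by
      rw [hρ, Real.exp_sub, show 3 * Real.log (T : ℝ) = Real.log ((T : ℝ) ^ 3) by
        rw [Real.log_pow]; norm_num, Real.exp_log (by positivity)]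
      gcongr
      linarith [Real.exp_one_lt_d9]) hb2)
  have hr' := expRestarts_budget hT0 hx1 he1 hx2 (Nat.lt_floor_add_one _).le hr
  -- the window in which a drift is detected
  have hy1 : 1 ≤ ⌈x ^ 2⌉₊ := Nat.one_le_ceil_iff.2 (by positivity)
  have hy : x ^ 2 ≤ (⌈x ^ 2⌉₊ : ℕ) := Nat.le_ceil _
  have hy2 : ((⌈x ^ 2⌉₊ : ℕ) : ℝ) ≤ 2 * x ^ 2 := by
    have := (Nat.ceil_lt_add_one (by positivity : 0 ≤ x ^ 2)).le
    nlinarith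
  generalize ⌈x ^ 2⌉₊ = y at hy1 hy hy2
  have hy1' : (1 : ℝ) ≤ y := by exact_mod_cast hy1
  have hη := drift_budget hD' hx1 he1 (by rw [hρ]; linarith :
    Real.log (1 / (1 / (T : ℝ) ^ 3)) ≤ 3 * e) hy hy2 hCgr
  have hP := deviation_budget (k := K) hD' hy1' hT' he (Nat.cast_nonneg _)
  have hmain := BaseBandit.integral_regret_adrPlay_le (B := B) (E := E) (c := |A| * Real.log T ^ p)
    (a := √(2 * (D * y) * e)) (x := x) (l := 4 * √(2 * (D * y) * e) / (D * y)) (by positivity)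
    (by positivity) (by positivity) hx0 (by positivity) hρ0 hy1 hCgr hc hM hE hE'
  rw [Nat.cast_mul] at hmain
  have hLs : (L : ℝ) ≤ √((L : ℝ) * K) :=
    Real.le_sqrt_of_sq_le (by rw [pow_two]; gcongr)
  have hsT : √((L : ℝ) * K) ≤ T :=
    Real.sqrt_le_iff.2 ⟨hT0.le, by rw [pow_two]; gcongr; linarith⟩
  refine hmain.trans ((regret_budget hT' hx1 he1 (by positivity)
    (by gcongr; linarith : |A| * Real.log T ^ p ≤ |A| * e ^ p) (Real.sq_sqrt (by positivity))
    (Real.sqrt_nonneg _) hsT (Nat.cast_nonneg L) hLs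
    (B.expRestarts_nonneg E _ T) hr' hD' hCgr hη hP).trans ?_)
  -- Since T ≥ 2 gives 1 ≤ 2 log T, e = 1 + log T is at most 3 log T; hence the factor 3^(p+1) in C.
  rw [hTx, mul_assoc _ (3 ^ (p + 1)) (Real.log T ^ (p + 1)), ← mul_pow]
  gcongr
  linarith
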